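/- **Stein's formulae on the sphere.** Let $n\ge 3$, $R>0$, let $\mathbb S^{n-1}(R)=\{x\in\mathbb R^n:\|x\|_2=R\}$, and let $z\sim\mathrm{Unif}(\mathbb S^{n-1}(R))$, i.e. $z$ is a random vector in $\mathbb S^{n-1}(R)$ distributed as $R\zeta/\|\zeta\|_2$ with $\zeta\sim N(0,I_n)$. For a smooth $h:\mathbb S^{n-1}(R)\to\mathbb R$ and $x\in\mathbb S^{n-1}(R)$ let $\nabla h(x)\in\mathbb R^n$ be the Euclidean gradient at $x$ of $y\mapsto h(Ry/\|y\|_2)$. For $\alpha\in\{1,2\}$ let $W^{1,\alpha}(\mathbb S^{n-1}(R))$ be the completion of the smooth functions on $\mathbb S^{n-1}(R)$ for the norm $\|h\|_{1,\alpha}=\mathbb E[|h(z)|^\alpha]^{1/\alpha}+\mathbb E[\|\nabla h(z)\|_2^\alpha]^{1/\alpha}$, the gradient being extended by continuity. For $f=(f_1,\dots,f_n)\in W^{1,\alpha}(\mathbb S^{n-1}(R))^n$ let $\nabla f\in\mathbb R^{n\times n}$ be the matrix with columns $\nabla f_1,\dots,\nabla f_n$, and let $P_x^\perp=I_n-xx^\top/\|x\|_2^2$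 for $x\ne 0$. All expectations below are finite, and: 1. For all $f\in W^{1,1}(\mathbb S^{n-1}(R))^n$, $$\mathbb E[f(z)^\top z]=\frac{R^2}{n-1}\,\mathbb E\big[\mathrm{tr}(\nabla f(z)^\top P_z^\perp)\big].$$ 2. For all $f\in W^{1,2}(\mathbb S^{n-1}(R))^n$, $$\mathbb E\big[\|f(z)-\mathbb E[f(z)]\|_2^2\big]\le\frac{R^2}{n-2}\,\mathbb E\big[\|\nabla f(z)^\top P_z^\perp\|_F^2\big].$$ 3. For all $f\in W^{1,2}(\mathbb S^{n-1}(R))^n$, $$\mathbb E\Big[\big(nR^{-2}f(z)^\top z-\mathrm{tr}(\nabla f(z)^\top P_z^\perp)\big)^2\Big] =\frac{n}{R^2}\mathbb E[\|f(z)\|_2^2]+\frac{n}{n-2}\mathbb E\,\mathrm{tr}\big[(\nabla f(z)^\top P_z^\perp)^2\big]-\frac{2}{n-2}\mathbb E\Big[\big(\mathrm{tr}(\nabla f(z)^\top P_z^\perp)\big)^2\Big]$$ $$\le\frac{n}{R^2}\mathbb E[\|f(z)\|_2^2]+\Big(1-\frac2n\Big)^{-1}\mathbb E\big[\|\nabla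 f(z)^\top P_z^\perp\|_F^2\big].$$ -/

import Mathlib

open MeasureTheory ProbabilityTheory

open scoped ENNReal Matrix

namespace SphereStein

noncomputable section

/-- The Euclidean space `ℝⁿ`. -/
abbrev Eu (n : ℕ) : Type := EuclideanSpace ℝ (Fin n)

/-- The sphere of radius `R` centred at the origin of `ℝⁿ`, as a subtype. -/
abbrev Sph (n : ℕ) (R : ℝ) : Type := Metric.sphere (0 : Eu n) R

/-- The uniform distribution on the sphere of radius `R`: the law of `R ζ / ‖ζ‖` with `ζ` a
standard Gaussian vector in `ℝⁿ`, viewed as a measure on the sphere. -/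
def unifSphere (n : ℕ) (R : ℝ) : Measure (Sph n R) :=
  ((stdGaussian (Eu n)).map (fun x => (R / ‖x‖) • x)).comap Subtype.val

open Classical in
/-- The extension `x ↦ h (R x / ‖x‖)` of a function `h` on the sphere of radius `R > 0`
to `ℝⁿ ∖ {0}`. (The value at the origin, where `R x / ‖x‖` is meaningless, is `0`.) -/
def radialExt {n : ℕ} {R : ℝ} (h : Sph n R → ℝ) (x : Eu n) : ℝ :=
  if hx : (R / ‖x‖) • x ∈ Metric.sphere (0 : Eu n) R then h ⟨(R / ‖x‖) • x, hx⟩ else 0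

/-- Infinitely differentiable functions on the sphere. -/
def SmoothOnSphere {n : ℕ} {R : ℝ} (h : Sph n R → ℝ) : Prop :=
  ContDiffOn ℝ ((⊤ : ℕ∞) : WithTop ℕ∞) (radialExt h) {0}ᶜ

/-- The gradient of a function on the sphere: the Euclidean gradient of its radial extension. -/
def sphereGrad {n : ℕ} {R : ℝ} (h : Sph n R → ℝ) (x : Sph n R) : Eu n :=
  gradient (radialExt h) (x : Eu n)

/-- The space `L^α × L^α(ℝⁿ)` over the sphere with its uniform distribution, with the norm
`‖(u, G)‖ = E[|u|^α]^{1/α} + E[‖G‖₂^α]^{1/α}`. On a pair `(h, ∇h)` it is the Sobolev norm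
of `h`. -/
abbrev LpPair (n : ℕ) (R : ℝ) (α : ℝ≥0∞) [Fact (1 ≤ α)] : Type :=
  WithLp 1 (Lp ℝ α (unifSphere n R) × Lp (Eu n) α (unifSphere n R))

/-- The pairs `(h, ∇h)` with `h` a smooth function on the sphere. -/
def smoothGraph (n : ℕ) (R : ℝ) (α : ℝ≥0∞) [Fact (1 ≤ α)] : Set (LpPair n R α) :=
  {p | ∃ h : Sph n R → ℝ, SmoothOnSphere h ∧
    p.fst =ᵐ[unifSphere n R] h ∧ p.snd =ᵐ[unifSphere n R] sphereGrad h}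

/-- The Sobolev space `W^{1,α}` of the sphere: the completion of the smooth functions for the
Sobolev norm. The map `h ↦ (h, ∇h)` is an isometry from the smooth functions with this norm into
the complete space `LpPair n R α`, so the completion is the closure of its range. An element of it
carries the function (first component) and its gradient (second component). -/
def Sobolev (n : ℕ) (R : ℝ) (α : ℝ≥0∞) [Fact (1 ≤ α)] : Set (LpPair n R α) :=
  closure (smoothGraph n R α)

variable {n : ℕ} {R : ℝ} {α : ℝ≥0∞} [Fact (1 ≤ α)]

/-- The `ℝⁿ`-valued function on the sphere given by `f = (f₁, …, fₙ)`, `fᵢ ∈ W^{1,α}`. -/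
def val (f : Fin n → Sobolev n R α) (x : Sph n R) : Eu n :=
  WithLp.toLp 2 (fun i => (f i : LpPair n R α).fst x)

/-- The gradient matrix of `f = (f₁, …, fₙ)`, with columns `∇f₁, …, ∇fₙ`. -/
def grad (f : Fin n → Sobolev n R α) (x : Sph n R) : Matrix (Fin n) (Fin n) ℝ :=
  Matrix.of (fun k i => (f i : LpPair n R α).snd x k)

/-- The projection `P_x^⊥ = I - x xᵀ / ‖x‖²`. -/
def projPerp (x : Eu n) : Matrix (Fin n) (Fin n) ℝ :=
  1 - (‖x‖ ^ 2)⁻¹ • Matrix.vecMulVec x x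

/-- The matrix `∇f(x)ᵀ P_x^⊥`. -/
def gradPerp (f : Fin n → Sobolev n R α) (x : Sph n R) : Matrix (Fin n) (Fin n) ℝ :=
  (grad f x)ᵀ * projPerp (x : Eu n)

/-- The squared Frobenius norm. -/
def frobSq (M : Matrix (Fin n) (Fin n) ℝ) : ℝ := ∑ i, ∑ j, M i j ^ 2

end

end SphereStein

/-!
The inequality comes from Gaussian space. For two independent standard Gaussian vectors `X`, `Y`,
the law of `(X, Y)` is invariant under the rotations of the plane they span, so for `F` smooth off
the origin `E (F X - F Y) ^ 2` can be averaged over the great circle `θ ↦ cos θ X + sin θ Y`; there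
`Y` is `X` after a quarter turn, and comparing Fourier coefficients bounds the average by that of
the squared derivative. This gives `Var F X ≤ E ‖DF X‖ ^ 2`. When `F` is constant along rays, `DF`
is homogeneous of degree `-1`, and the independence of `‖X‖` and `X / ‖X‖` together with
`E ‖X‖⁻² = 1 / (n - 2)` turns this into the Poincaré inequality on the sphere.

The identities come from rotation invariance alone. Differentiating `∫ g` along the rotations that
preserve it yields, for a vector field `V` homogeneous of degree `d`, the divergence theorem
`(n - 1 + d) ∫ ⟪x, V⟫ = R ^ 2 ∫ div V`. The field `F`, of degree `0`, gives the first-order formula;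
the fields `⟪x, F⟫ F`, of degree `1`, and `(div F) F - DF F`, of degree `-1`, give the second-order
one, because the terms `⟪x, DF F⟫` cancel. Each statement passes to the Sobolev space by density,
both sides being continuous.
-/

namespace SphereStein

section PuncturedSpace

variable {E G : Type*} [NormedAddCommGroup E] [NormedSpace ℝ E] [NormedAddCommGroup G]
  [NormedSpace ℝ G] {V : E → G}

lemma differentiableAt_of_contDiffOn_compl_zero (hV : ContDiffOn ℝ 1 V {0}ᶜ) {x : E} (hx : x ≠ 0) :
    DifferentiableAt ℝ V x :=
  (hV.differentiableOn one_ne_zero).differentiableAt (isOpen_compl_singleton.mem_nhds hx)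

lemma continuousOn_fderiv_of_contDiffOn_compl_zero (hV : ContDiffOn ℝ 1 V {0}ᶜ) :
    ContinuousOn (fderiv ℝ V) {0}ᶜ :=
  hV.continuousOn_fderiv_of_isOpen isOpen_compl_singleton le_rfl

end PuncturedSpace

section Homogeneous

variable {E G H : Type*} [NormedAddCommGroup E] [NormedSpace ℝ E]
  [NormedAddCommGroup G] [NormedSpace ℝ G] [NormedAddCommGroup H] [NormedSpace ℝ H] {d e : ℤ}

/-- Positive homogeneity of integer degree `d`; the degree may be negative, and nothing is asked
at the origin beyond `V 0 = c ^ d • V 0`. -/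
def IsPosHomogeneous (d : ℤ) (V : E → G) : Prop :=
  ∀ ⦃c : ℝ⦄, 0 < c → ∀ x, V (c • x) = c ^ d • V x

namespace IsPosHomogeneous

lemma fderiv {V : E → G} (hV : IsPosHomogeneous d V) : IsPosHomogeneous (d - 1) (fderiv ℝ V) := by
  intro c hc x
  have hscale : _root_.fderiv ℝ (fun y => V (c • y)) x = c • _root_.fderiv ℝ V (c • x) :=
    fderiv_comp_smul c
  have hhom : _root_.fderiv ℝ (fun y => V (c • y)) x = c ^ d • _root_.fderiv ℝ V x := by
    rw [funext (hV hc)]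
    exact congrFun (fderiv_const_smul_field (c ^ d)) x
  rw [zpow_sub_one₀ hc.ne', mul_comm, mul_smul, ← hhom, hscale, inv_smul_smul₀ hc.ne']

lemma fderiv_apply_self {V : E → G} (hV : IsPosHomogeneous d V) {x : E}
    (hx : DifferentiableAt ℝ V x) : _root_.fderiv ℝ V x x = (d : ℝ) • V x := by
  have hray : HasDerivAt (fun c : ℝ => V (c • x)) (_root_.fderiv ℝ V x x) 1 := by
    have hline : HasDerivAt (fun c : ℝ => c • x) x 1 := by
      simpa using (hasDerivAt_id (1 : ℝ)).smul_const x
    exact HasFDerivAt.comp_hasDerivAt_of_eq _ hx.hasFDerivAt hline (one_smul ℝ x).symm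
  have hpow : HasDerivAt (fun c : ℝ => c ^ d • V x) ((d : ℝ) • V x) 1 := by
    simpa using (hasDerivAt_zpow d (1 : ℝ) (Or.inl one_ne_zero)).smul_const (V x)
  refine hray.unique (hpow.congr_of_eventuallyEq ?_)
  filter_upwards [lt_mem_nhds one_pos] with c hc using hV hc x

lemma smul {φ : E → ℝ} {V : E → G} (hφ : IsPosHomogeneous d φ) (hV : IsPosHomogeneous e V) :
    IsPosHomogeneous (d + e) (fun x => φ x • V x) := fun c hc x => by
  simp only [hφ hc x, hV hc x, zpow_add₀ hc.ne', smul_eq_mul, smul_smul]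
  congr 1
  ring

lemma sub {V W : E → G} (hV : IsPosHomogeneous d V) (hW : IsPosHomogeneous d W) :
    IsPosHomogeneous d (fun x => V x - W x) := fun c hc x => by
  simp only [hV hc x, hW hc x, smul_sub]

lemma clm_apply {L : E → G →L[ℝ] H} {V : E → G} (hL : IsPosHomogeneous d L)
    (hV : IsPosHomogeneous e V) : IsPosHomogeneous (d + e) (fun x => L x (V x)) := fun c hc x => by
  simp [hL hc x, hV hc x, zpow_add₀ hc.ne', smul_smul, mul_comm]

lemma clm_comp {V : E → G} (hV : IsPosHomogeneous d V) (L : G →ₗ[ℝ] H) :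
    IsPosHomogeneous d (fun x => L (V x)) := fun c hc x => by
  simp only [hV hc x, map_smul]

end IsPosHomogeneous

end Homogeneous

section Gaussian

variable {E : Type*} [NormedAddCommGroup E] [InnerProductSpace ℝ E]

/-- The density of the standard Gaussian measure with respect to the Lebesgue measure. -/
noncomputable def gaussDensity (x : E) : ℝ :=
  (2 * Real.pi) ^ (-((Module.finrank ℝ E : ℝ) / 2)) * Real.exp (-(1 / 2) * ‖x‖ ^ 2)

lemma gaussDensity_nonneg (x : E) : 0 ≤ gaussDensity x := by
  unfold gaussDensity; positivity

@[fun_prop]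
lemma continuous_gaussDensity : Continuous (gaussDensity : E → ℝ) := by
  unfold gaussDensity; fun_prop

variable [FiniteDimensional ℝ E] [MeasurableSpace E] [BorelSpace E]

lemma integrable_gaussDensity : Integrable (gaussDensity : E → ℝ) := by
  have hexp := (GaussianFourier.integrable_cexp_neg_mul_sq_norm_add (V := E) (b := (1 / 2 : ℂ))
    (by norm_num) 0 0).norm
  refine (hexp.const_mul ((2 * Real.pi) ^ (-((Module.finrank ℝ E : ℝ) / 2)))).congr
    (.of_forall fun x => ?_)
  simp only [gaussDensity, Complex.norm_exp]
  congr 2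
  simp [← Complex.ofReal_pow]

lemma integral_gaussDensity_smul_cexp_inner (t : E) :
    ∫ x, gaussDensity x • Complex.exp (inner ℝ x t * Complex.I) =
      Complex.exp (-‖t‖ ^ 2 / 2) := by
  have hfourier := GaussianFourier.integral_cexp_neg_mul_sq_norm_add (V := E) (b := (1 / 2 : ℂ))
    (by norm_num) Complex.I t
  have hsplit (x : E) : gaussDensity x • Complex.exp (inner ℝ x t * Complex.I) =
      (((2 * Real.pi) ^ (-((Module.finrank ℝ E : ℝ) / 2)) : ℝ) : ℂ) *
        Complex.exp (-(1 / 2) * ‖x‖ ^ 2 + Complex.I * inner ℝ t x) := by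
    rw [Complex.exp_add, gaussDensity, real_inner_comm, Complex.real_smul]
    push_cast
    rw [mul_comm Complex.I]
    ring
  have hnormalize : (((2 * Real.pi) ^ (-((Module.finrank ℝ E : ℝ) / 2)) : ℝ) : ℂ) *
      ((Real.pi : ℂ) / (1 / 2)) ^ ((Module.finrank ℝ E : ℂ) / 2) = 1 := by
    have hbase : (Real.pi : ℂ) / (1 / 2) = ((2 * Real.pi : ℝ) : ℂ) := by push_cast; ring
    have hexponent : (Module.finrank ℝ E : ℂ) / 2 = ((Module.finrank ℝ E : ℝ) / 2 : ℝ) := by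
      push_cast; ring
    rw [hbase, hexponent, ← Complex.ofReal_cpow (by positivity), ← Complex.ofReal_mul,
      ← Real.rpow_add (by positivity), neg_add_cancel, Real.rpow_zero, Complex.ofReal_one]
  simp_rw [hsplit]
  rw [integral_const_mul, hfourier, ← mul_assoc, hnormalize, one_mul, Complex.I_sq]
  congr 1
  ring

lemma stdGaussian_eq_withDensity :
    stdGaussian E = volume.withDensity fun x => ENNReal.ofReal (gaussDensity x) := by
  have : IsFiniteMeasure (volume.withDensity fun x : E => ENNReal.ofReal (gaussDensity x)) :=
    isFiniteMeasure_withDensity_ofReal integrable_gaussDensity.2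
  refine Measure.ext_of_charFun (funext fun t => ?_)
  rw [charFun_stdGaussian, charFun_apply,
    integral_withDensity_eq_integral_toReal_smul (by fun_prop) (by simp)]
  simp only [ENNReal.toReal_ofReal (gaussDensity_nonneg _),
    integral_gaussDensity_smul_cexp_inner]

lemma stdGaussian_absolutelyContinuous : stdGaussian E ≪ volume := by
  rw [stdGaussian_eq_withDensity]
  exact withDensity_absolutelyContinuous _ _

lemma ae_stdGaussian_notMem_of_ne_top {S : Submodule ℝ E} (hS : S ≠ ⊤) :
    ∀ᵐ x ∂stdGaussian E, x ∉ S :=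
  stdGaussian_absolutelyContinuous.ae_le
    (measure_eq_zero_iff_ae_notMem.1 (Measure.addHaar_submodule _ S hS))

lemma ae_stdGaussian_ne_zero [Nontrivial E] : ∀ᵐ x ∂stdGaussian E, x ≠ 0 := by
  simpa using ae_stdGaussian_notMem_of_ne_top (bot_ne_top (α := Submodule ℝ E))

end Gaussian

section Radial

open Set Metric

variable {E : Type*} [NormedAddCommGroup E]

lemma lintegral_eq_lintegral_toSphere [NormedSpace ℝ E] [FiniteDimensional ℝ E]
    [MeasurableSpace E] [BorelSpace E] [Nontrivial E] (μ : Measure E) [μ.IsAddHaarMeasure]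
    {f : E → ℝ≥0∞} (hf : Measurable f) :
    ∫⁻ x, f x ∂μ = ∫⁻ u : sphere (0 : E) 1, (∫⁻ r in Ioi (0 : ℝ),
      ENNReal.ofReal (r ^ (Module.finrank ℝ E - 1)) * f (r • (u : E))) ∂μ.toSphere := by
  have hpolar := μ.measurePreserving_homeomorphUnitSphereProd.symm
    (homeomorphUnitSphereProd E).toMeasurableEquiv
  have hmeas : Measurable fun p : sphere (0 : E) 1 × Ioi (0 : ℝ) => f ((p.2 : ℝ) • (p.1 : E)) := by
    fun_prop
  calc ∫⁻ x, f x ∂μ = ∫⁻ x : ({0}ᶜ : Set E), f x ∂μ.comap (↑) := by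
        rw [lintegral_subtype_comap (measurableSet_singleton _).compl, restrict_compl_singleton]
    _ = ∫⁻ p, f ((p.2 : ℝ) • (p.1 : E)) ∂μ.toSphere.prod
        (Measure.volumeIoiPow (Module.finrank ℝ E - 1)) :=
      (hpolar.lintegral_comp (hf.comp measurable_subtype_coe)).symm
    _ = _ := by
      rw [lintegral_prod _ hmeas.aemeasurable]
      refine lintegral_congr fun u => ?_
      have hm : Measurable fun r : Ioi (0 : ℝ) => f ((r : ℝ) • (u : E)) := by fun_prop
      rw [Measure.volumeIoiPow, lintegral_withDensity_eq_lintegral_mul _ (by fun_prop) hm]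
      exact lintegral_subtype_comap measurableSet_Ioi
        (fun r : ℝ => ENNReal.ofReal (r ^ (Module.finrank ℝ E - 1)) * f (r • (u : E)))

variable [InnerProductSpace ℝ E] [FiniteDimensional ℝ E] [MeasurableSpace E] [BorelSpace E]

lemma lintegral_rpow_mul_exp_neg_sq_div_two {p : ℝ} (hp : -1 < p) :
    ∫⁻ r in Ioi (0 : ℝ), ENNReal.ofReal (r ^ p * Real.exp (-(1 / 2) * r ^ 2)) =
      ENNReal.ofReal ((1 / 2) ^ (-(p + 1) / 2) * (1 / 2) * Real.Gamma ((p + 1) / 2)) := by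
  have hint := integrableOn_rpow_mul_exp_neg_mul_sq (b := 1 / 2) (by norm_num) hp
  have hval := integral_rpow_mul_exp_neg_mul_rpow (p := 2) (b := 1 / 2) two_pos hp (by norm_num)
  simp only [Real.rpow_two] at hval
  rw [← hval, ofReal_integral_eq_lintegral_ofReal hint]
  filter_upwards [ae_restrict_mem measurableSet_Ioi] with r (hr : 0 < r)
  positivity

lemma lintegral_norm_rpow_mul_stdGaussian_eq_toSphere [Nontrivial E] {s : ℝ}
    (hs : 0 < Module.finrank ℝ E + s) {q : E → ℝ≥0∞} (hq : Measurable q)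
    (hhom : ∀ ⦃c : ℝ⦄, 0 < c → ∀ x, q (c • x) = q x) :
    ∫⁻ x, ENNReal.ofReal (‖x‖ ^ s) * q x ∂stdGaussian E =
      ENNReal.ofReal ((2 * Real.pi) ^ (-((Module.finrank ℝ E : ℝ) / 2)) *
        (2 ^ ((Module.finrank ℝ E + s) / 2 - 1) * Real.Gamma ((Module.finrank ℝ E + s) / 2))) *
      ∫⁻ u : sphere (0 : E) 1, q u ∂(volume : Measure E).toSphere := by
  have hdim : 0 < Module.finrank ℝ E := Module.finrank_pos
  have hradial (u : sphere (0 : E) 1) {r : ℝ} (hr : 0 < r) :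
      ENNReal.ofReal (r ^ (Module.finrank ℝ E - 1)) * (ENNReal.ofReal (gaussDensity (r • (u : E))) *
        (ENNReal.ofReal (‖r • (u : E)‖ ^ s) * q (r • (u : E)))) =
      ENNReal.ofReal ((2 * Real.pi) ^ (-((Module.finrank ℝ E : ℝ) / 2))) *
        ENNReal.ofReal (r ^ (Module.finrank ℝ E + s - 1) * Real.exp (-(1 / 2) * r ^ 2)) * q u := by
    have hpow : r ^ (Module.finrank ℝ E - 1) * r ^ s = r ^ (Module.finrank ℝ E + s - 1) := by
      rw [← Real.rpow_natCast, ← Real.rpow_add hr, Nat.cast_pred hdim]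
      ring_nf
    rw [hhom hr, ← mul_assoc, ← mul_assoc, ← ENNReal.ofReal_mul (by positivity),
      ← ENNReal.ofReal_mul (mul_nonneg (by positivity) (gaussDensity_nonneg _)),
      ← ENNReal.ofReal_mul (by positivity), gaussDensity, norm_smul, norm_eq_of_mem_sphere u,
      mul_one, Real.norm_of_nonneg hr.le, ← hpow]
    ring_nf
  have hray (u : sphere (0 : E) 1) :
      ∫⁻ r in Ioi (0 : ℝ), ENNReal.ofReal (r ^ (Module.finrank ℝ E - 1)) *
        (ENNReal.ofReal (gaussDensity (r • (u : E))) *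
          (ENNReal.ofReal (‖r • (u : E)‖ ^ s) * q (r • (u : E)))) =
      ENNReal.ofReal ((2 * Real.pi) ^ (-((Module.finrank ℝ E : ℝ) / 2)) *
        (2 ^ ((Module.finrank ℝ E + s) / 2 - 1) * Real.Gamma ((Module.finrank ℝ E + s) / 2))) *
        q u := by
    rw [setLIntegral_congr_fun measurableSet_Ioi fun r (hr : 0 < r) => hradial u hr,
      lintegral_mul_const _ (by fun_prop), lintegral_const_mul _ (by fun_prop),
      lintegral_rpow_mul_exp_neg_sq_div_two (by linarith), ← ENNReal.ofReal_mul (by positivity)]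
    congr 3
    rw [sub_add_cancel, one_div, Real.inv_rpow two_pos.le, ← Real.rpow_neg two_pos.le,
      Real.rpow_sub_one two_ne_zero]
    ring_nf
  rw [stdGaussian_eq_withDensity, lintegral_withDensity_eq_lintegral_mul _ (by fun_prop)
    (by fun_prop), lintegral_eq_lintegral_toSphere _ (by fun_prop)]
  simp only [Pi.mul_apply, hray]
  exact lintegral_const_mul _ (by fun_prop)

/-- Under the standard Gaussian measure, the norm and the direction are independent. -/
lemma lintegral_norm_rpow_mul_stdGaussian [Nontrivial E] {s : ℝ}
    (hs : 0 < Module.finrank ℝ E + s) {q : E → ℝ≥0∞} (hq : Measurable q)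
    (hhom : ∀ ⦃c : ℝ⦄, 0 < c → ∀ x, q (c • x) = q x) :
    ∫⁻ x, ENNReal.ofReal (‖x‖ ^ s) * q x ∂stdGaussian E =
      ENNReal.ofReal (2 ^ (s / 2) * Real.Gamma ((Module.finrank ℝ E + s) / 2) /
        Real.Gamma ((Module.finrank ℝ E : ℝ) / 2)) * ∫⁻ x, q x ∂stdGaussian E := by
  have hdim : (0 : ℝ) < Module.finrank ℝ E := by exact_mod_cast Module.finrank_pos
  have hgamma : 0 < Real.Gamma ((Module.finrank ℝ E : ℝ) / 2) :=
    Real.Gamma_pos_of_pos (by linarith)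
  have hgamma_s : 0 < Real.Gamma ((Module.finrank ℝ E + s) / 2) :=
    Real.Gamma_pos_of_pos (by linarith)
  have hzero := lintegral_norm_rpow_mul_stdGaussian_eq_toSphere (s := 0) (by simpa using hdim)
    hq hhom
  simp only [Real.rpow_zero, ENNReal.ofReal_one, one_mul, add_zero] at hzero
  rw [lintegral_norm_rpow_mul_stdGaussian_eq_toSphere hs hq hhom, hzero,
    ← mul_assoc _ (ENNReal.ofReal _),
    ← ENNReal.ofReal_mul (div_pos (mul_pos (by positivity) hgamma_s) hgamma).le]
  congr 2
  rw [add_div, add_sub_right_comm, Real.rpow_add two_pos]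
  field_simp [hgamma.ne']

lemma lintegral_inv_norm_sq_mul_stdGaussian (hdim : 3 ≤ Module.finrank ℝ E) {q : E → ℝ≥0∞}
    (hq : Measurable q) (hhom : ∀ ⦃c : ℝ⦄, 0 < c → ∀ x, q (c • x) = q x) :
    ∫⁻ x, ENNReal.ofReal (‖x‖ ^ 2)⁻¹ * q x ∂stdGaussian E =
      ENNReal.ofReal ((Module.finrank ℝ E : ℝ) - 2)⁻¹ * ∫⁻ x, q x ∂stdGaussian E := by
  have : Nontrivial E := Module.nontrivial_of_finrank_pos (R := ℝ) (by lia)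
  have hdim' : (3 : ℝ) ≤ Module.finrank ℝ E := by exact_mod_cast hdim
  have hgamma : Real.Gamma ((Module.finrank ℝ E : ℝ) / 2) =
      ((Module.finrank ℝ E : ℝ) / 2 - 1) * Real.Gamma ((Module.finrank ℝ E : ℝ) / 2 - 1) := by
    rw [← Real.Gamma_add_one (by linarith), sub_add_cancel]
  have hgamma_ne : Real.Gamma ((Module.finrank ℝ E : ℝ) / 2 - 1) ≠ 0 :=
    (Real.Gamma_pos_of_pos (by linarith)).ne'
  have hmoment := lintegral_norm_rpow_mul_stdGaussian (s := -2) (by linarith) hq hhom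
  simp only [Real.rpow_neg (norm_nonneg _), Real.rpow_two] at hmoment
  rw [hmoment, hgamma, add_div, neg_div, div_self two_ne_zero, ← sub_eq_add_neg,
    mul_div_mul_right _ _ hgamma_ne, Real.rpow_neg_one]
  congr 2
  rw [div_eq_mul_inv, ← mul_inv]
  ring_nf

end Radial

section Circle

lemma norm_zpow_sub_one_le {w : ℂ} (hw : ‖w‖ = 1) (k : ℤ) : ‖w ^ k - 1‖ ≤ |(k : ℝ)| * ‖w - 1‖ := by
  have hnat (m : ℕ) : ‖w ^ m - 1‖ ≤ m * ‖w - 1‖ := by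
    rw [← mul_geom_sum, norm_mul, mul_comm]
    gcongr
    simpa [hw] using norm_sum_le (Finset.range m) (fun i => w ^ i)
  obtain ⟨m, rfl | rfl⟩ := k.eq_nat_or_neg
  · simpa using hnat m
  · have hinv : w ^ (-(m : ℤ)) - 1 = -(w ^ (-(m : ℤ)) * (w ^ m - 1)) := by
      have hw0 : w ≠ 0 := norm_ne_zero_iff.1 (by simp [hw])
      rw [mul_sub, zpow_neg, zpow_natCast, inv_mul_cancel₀ (pow_ne_zero m hw0)]
      ring
    rw [hinv, norm_neg, norm_mul]
    simpa [hw] using hnat m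

variable {T : ℝ} [Fact (0 < T)]

lemma fourierCoeff_comp_add_right (G : AddCircle T → ℂ) (h : AddCircle T) (k : ℤ) :
    fourierCoeff (fun x => G (x + h)) k = fourier k h * fourierCoeff G k := by
  have hphase (x : AddCircle T) : fourier (-k) x = fourier k h * fourier (-k) (x + h) := by
    simp only [fourier_apply, ← Circle.coe_mul, ← AddCircle.toCircle_add]
    congr 2
    simp only [neg_smul, smul_add]
    abel
  calc fourierCoeff (fun x => G (x + h)) k
      = ∫ x, fourier k h * (fourier (-k) (x + h) * G (x + h)) ∂AddCircle.haarAddCircle := by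
        simp only [fourierCoeff, smul_eq_mul, ← mul_assoc, ← hphase]
    _ = fourier k h * fourierCoeff G k := by
        rw [integral_const_mul, integral_add_right_eq_self (fun x => fourier (-k) x * G x)]
        rfl

lemma fourierCoeff_shift_sub (G : C(AddCircle T, ℂ)) (h : AddCircle T) (k : ℤ) :
    fourierCoeff (G.comp (.addRight h) - G) k = (fourier 1 h ^ k - 1) * fourierCoeff G k := by
  have hintegrable (K : C(AddCircle T, ℂ)) : Integrable K AddCircle.haarAddCircle :=
    K.continuous.integrable_of_hasCompactSupport (.of_compactSpace _)
  have hfourier : fourier k h = fourier 1 h ^ k := by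
    simp [fourier_apply, AddCircle.toCircle_zsmul]
  have hshift := fourierCoeff_comp_add_right G h k
  have hsum := congrFun
    (fourierCoeff.add (hintegrable (G.comp (.addRight h) - G)) (hintegrable G)) k
  rw [← ContinuousMap.coe_add, sub_add_cancel, Pi.add_apply] at hsum
  rw [← hfourier, sub_mul, one_mul, ← hshift]
  exact eq_sub_of_add_eq hsum.symm

lemma fourierCoeff_deriv {G G' : C(AddCircle T, ℂ)}
    (hG : ∀ x : ℝ, HasDerivAt (fun y : ℝ => G y) (G' x) x) (k : ℤ) :
    fourierCoeff G' k = 2 * Real.pi * Complex.I * k / T * fourierCoeff G k := by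
  have hparts := intervalIntegral.integral_mul_deriv_eq_deriv_mul (a := 0) (b := T)
    (fun x _ => hasDerivAt_fourier_neg T k x) (fun x _ => hG x)
    (Continuous.intervalIntegrable (by fun_prop) _ _)
    (Continuous.intervalIntegrable (by fun_prop) _ _)
  have hends : ((T : ℝ) : AddCircle T) = ((0 : ℝ) : AddCircle T) := by simp
  simp only [hends, sub_self, zero_sub, mul_assoc (_ / _ : ℂ),
    intervalIntegral.integral_const_mul] at hparts
  rw [fourierCoeff_eq_intervalIntegral _ _ 0, fourierCoeff_eq_intervalIntegral _ _ 0, zero_add]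
  simp only [smul_eq_mul, Complex.real_smul]
  rw [hparts]
  ring

lemma hasSum_sq_fourierCoeff_of_continuous (G : C(AddCircle T, ℂ)) :
    HasSum (fun k => ‖fourierCoeff G k‖ ^ 2) (∫ x, ‖G x‖ ^ 2 ∂AddCircle.haarAddCircle) := by
  have hsum := hasSum_sq_fourierCoeff (ContinuousMap.toLp 2 AddCircle.haarAddCircle ℂ G)
  simp only [fourierCoeff_toLp] at hsum
  convert hsum using 1
  refine integral_congr_ae ?_
  filter_upwards [ContinuousMap.coeFn_toLp (p := 2) (𝕜 := ℂ) AddCircle.haarAddCircle G] with x hx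
  rw [hx]

/-- Both sides are compared Fourier coefficient by Fourier coefficient. -/
lemma integral_norm_shift_sub_sq_le {G G' : C(AddCircle T, ℂ)}
    (hG : ∀ x : ℝ, HasDerivAt (fun y : ℝ => G y) (G' x) x) (h : AddCircle T) :
    ∫ x, ‖G (x + h) - G x‖ ^ 2 ∂AddCircle.haarAddCircle ≤
      (T / (2 * Real.pi) * ‖fourier 1 h - 1‖) ^ 2 *
        ∫ x, ‖G' x‖ ^ 2 ∂AddCircle.haarAddCircle := by
  have hT : 0 < T := Fact.out
  have hunit : ‖fourier 1 h‖ = 1 := by rw [fourier_apply, Circle.norm_coe]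
  have hshift := hasSum_sq_fourierCoeff_of_continuous (G.comp (.addRight h) - G)
  have hderiv := (hasSum_sq_fourierCoeff_of_continuous G').mul_left
    ((T / (2 * Real.pi) * ‖fourier 1 h - 1‖) ^ 2)
  refine hasSum_le (fun k => ?_) hshift hderiv
  rw [fourierCoeff_shift_sub, fourierCoeff_deriv hG, ← mul_pow]
  gcongr
  calc ‖(fourier 1 h ^ k - 1) * fourierCoeff G k‖
      ≤ |(k : ℝ)| * ‖fourier 1 h - 1‖ * ‖fourierCoeff G k‖ := by
        rw [norm_mul]
        gcongr
        exact norm_zpow_sub_one_le hunit k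
    _ = _ := by
        simp [abs_of_pos hT, abs_of_pos Real.pi_pos]
        field_simp

end Circle

section GreatCircle

lemma integral_shift_sub_sq_le_of_periodic {T : ℝ} (hT : 0 < T) {f f' : ℝ → ℝ}
    (hf : ∀ θ, HasDerivAt f (f' θ) θ) (hf' : Continuous f') (hper : f.Periodic T) (h : ℝ) :
    ∫ θ in 0..T, (f (θ + h) - f θ) ^ 2 ≤
      (T / (2 * Real.pi) * ‖fourier 1 (h : AddCircle T) - 1‖) ^ 2 * ∫ θ in 0..T, f' θ ^ 2 := by
  have : Fact (0 < T) := ⟨hT⟩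
  have hper' : f'.Periodic T := fun θ =>
    ((hf _).comp_add_const θ T).unique (by simpa only [hper _] using hf θ)
  have hcont : Continuous f := continuous_iff_continuousAt.2 fun θ => (hf θ).continuousAt
  let G : C(AddCircle T, ℂ) :=
    ⟨fun x => hper.lift x, Complex.continuous_ofReal.comp (continuous_coinduced_dom.2 hcont)⟩
  let G' : C(AddCircle T, ℂ) :=
    ⟨fun x => hper'.lift x, Complex.continuous_ofReal.comp (continuous_coinduced_dom.2 hf')⟩
  have hcircle := integral_norm_shift_sub_sq_le (G := G) (G' := G')
    (fun θ => (hf θ).ofReal_comp) (h : AddCircle T)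
  simp only [AddCircle.integral_haarAddCircle, smul_eq_mul,
    ← AddCircle.intervalIntegral_preimage T 0, zero_add] at hcircle
  rw [mul_left_comm, mul_le_mul_iff_right₀ (inv_pos.2 hT)] at hcircle
  have hG (θ : ℝ) : ‖G (θ + h) - G θ‖ ^ 2 = (f (θ + h) - f θ) ^ 2 := by
    rw [← sq_abs (f (θ + h) - f θ), ← Real.norm_eq_abs, ← Complex.norm_real]
    exact congrArg (‖·‖ ^ 2) (Complex.ofReal_sub _ _).symm
  have hG' (θ : ℝ) : ‖G' θ‖ ^ 2 = f' θ ^ 2 := by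
    rw [← sq_abs (f' θ), ← Real.norm_eq_abs, ← Complex.norm_real]
    rfl
  simpa only [hG, hG'] using hcircle

/-- Here `2 = ‖exp (i π / 2) - 1‖ ^ 2`. -/
lemma integral_quarter_turn_sub_sq_le {f f' : ℝ → ℝ} (hf : ∀ θ, HasDerivAt f (f' θ) θ)
    (hf' : Continuous f') (hper : f.Periodic (2 * Real.pi)) :
    ∫ θ in 0..2 * Real.pi, (f (θ + Real.pi / 2) - f θ) ^ 2 ≤
      2 * ∫ θ in 0..2 * Real.pi, f' θ ^ 2 := by
  have hchord : ‖(fourier 1 ((Real.pi / 2 : ℝ) : AddCircle (2 * Real.pi)) : ℂ) - 1‖ ^ 2 = 2 := by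
    have hquarter : (fourier 1 ((Real.pi / 2 : ℝ) : AddCircle (2 * Real.pi)) : ℂ) = Complex.I := by
      rw [fourier_one, AddCircle.toCircle_apply_mk, div_self Real.two_pi_pos.ne', one_mul,
        Circle.coe_exp, Complex.ofReal_div, Complex.ofReal_ofNat, Complex.exp_pi_div_two_mul_I]
    rw [hquarter, Complex.sq_norm, Complex.normSq_apply]
    norm_num
  have h := integral_shift_sub_sq_le_of_periodic Real.two_pi_pos hf hf' hper (Real.pi / 2)
  rwa [div_self Real.two_pi_pos.ne', one_mul, hchord] at h

variable {E : Type*} [NormedAddCommGroup E]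

lemma rotation_add_pi_div_two_fst [NormedSpace ℝ E] (θ : ℝ) (p : E × E) :
    (ContinuousLinearMap.rotation (θ + Real.pi / 2) p).1 =
      (ContinuousLinearMap.rotation θ p).2 := by
  simp only [ContinuousLinearMap.rotation_apply, Real.cos_add_pi_div_two, Real.sin_add_pi_div_two]

lemma rotation_fst_ne_zero [NormedSpace ℝ E] {p : E × E} (hp1 : p.1 ≠ 0)
    (hp2 : p.2 ∉ ℝ ∙ p.1) (θ : ℝ) : (ContinuousLinearMap.rotation θ p).1 ≠ 0 := by
  simp only [ContinuousLinearMap.rotation_apply]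
  intro hzero
  have hsin : Real.sin θ = 0 := by
    by_contra hsin
    refine hp2 (Submodule.mem_span_singleton.2 ⟨-(Real.sin θ)⁻¹ * Real.cos θ, ?_⟩)
    rw [mul_smul, eq_neg_of_add_eq_zero_left hzero, neg_smul, smul_neg, neg_neg,
      inv_smul_smul₀ hsin]
  have hcos : Real.cos θ = 0 := by simpa [hsin, hp1] using hzero
  simpa [hsin, hcos] using Real.cos_sq_add_sin_sq θ

lemma lintegral_Ioc_enorm_sq {T : ℝ} (hT : 0 ≤ T) {g : ℝ → ℝ} (hg : Continuous g) :
    ∫⁻ θ in Set.Ioc 0 T, ‖g θ‖ₑ ^ 2 = ENNReal.ofReal (∫ θ in 0..T, g θ ^ 2) := by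
  rw [intervalIntegral.integral_of_le hT, ofReal_integral_eq_lintegral_ofReal
    (by fun_prop : Continuous fun θ => g θ ^ 2).integrableOn_Ioc (.of_forall fun θ => sq_nonneg _)]
  simp only [← Real.enorm_of_nonneg (sq_nonneg _), enorm_pow]

lemma lintegral_rotation_sub_sq_le [NormedSpace ℝ E] {F : E → ℝ} (hF : ContDiffOn ℝ 1 F {0}ᶜ)
    {p : E × E} (hp1 : p.1 ≠ 0) (hp2 : p.2 ∉ ℝ ∙ p.1) :
    ∫⁻ θ in Set.Ioc 0 (2 * Real.pi), ‖F (ContinuousLinearMap.rotation θ p).1 -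
        F (ContinuousLinearMap.rotation θ p).2‖ₑ ^ 2 ≤
      2 * ∫⁻ θ in Set.Ioc 0 (2 * Real.pi), ‖fderiv ℝ F (ContinuousLinearMap.rotation θ p).1
        (ContinuousLinearMap.rotation θ p).2‖ₑ ^ 2 := by
  set P : ℝ → E × E := fun θ => ContinuousLinearMap.rotation θ p with hP
  have hP1 (θ : ℝ) : HasDerivAt (fun θ => (P θ).1) (P θ).2 θ := by
    simpa [hP, ContinuousLinearMap.rotation_apply] using
      ((Real.hasDerivAt_cos θ).smul_const p.1).fun_add ((Real.hasDerivAt_sin θ).smul_const p.2)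
  have hP2 : Continuous fun θ => (P θ).2 := by
    simp only [hP, ContinuousLinearMap.rotation_apply]
    fun_prop
  have hne (θ : ℝ) : (P θ).1 ∈ ({0}ᶜ : Set E) := rotation_fst_ne_zero hp1 hp2 θ
  have hderiv (θ : ℝ) : HasDerivAt (fun θ => F (P θ).1) (fderiv ℝ F (P θ).1 (P θ).2) θ :=
    (differentiableAt_of_contDiffOn_compl_zero hF (hne θ)).hasFDerivAt.comp_hasDerivAt θ (hP1 θ)
  have hcont : Continuous fun θ => fderiv ℝ F (P θ).1 (P θ).2 :=
    ((continuousOn_fderiv_of_contDiffOn_compl_zero hF).comp_continuous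
      (continuous_iff_continuousAt.2 fun θ => (hP1 θ).continuousAt) hne).clm_apply hP2
  have hper : (fun θ => F (P θ).1).Periodic (2 * Real.pi) := fun θ => by
    simp [hP, ContinuousLinearMap.rotation_apply]
  have hcircle := integral_quarter_turn_sub_sq_le hderiv hcont hper
  simp only [hP, rotation_add_pi_div_two_fst, sub_sq_comm] at hcircle
  have hF1 : Continuous fun θ => F (P θ).1 :=
    continuous_iff_continuousAt.2 fun θ => (hderiv θ).continuousAt
  have hF2 : Continuous fun θ => F (P θ).2 := by
    simp only [hP, ← rotation_add_pi_div_two_fst]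
    exact hF1.comp (continuous_add_const (Real.pi / 2))
  rw [lintegral_Ioc_enorm_sq Real.two_pi_pos.le (hF1.fun_sub hF2),
    lintegral_Ioc_enorm_sq Real.two_pi_pos.le hcont, ← ENNReal.ofReal_ofNat,
    ← ENNReal.ofReal_mul zero_le_two]
  exact ENNReal.ofReal_le_ofReal hcircle

variable [InnerProductSpace ℝ E] [FiniteDimensional ℝ E] [MeasurableSpace E] [BorelSpace E]

lemma measurable_comp_rotation {H : E × E → ℝ≥0∞} (hH : Measurable H) :
    Measurable fun q : (E × E) × ℝ => H (ContinuousLinearMap.rotation q.2 q.1) := by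
  simp only [ContinuousLinearMap.rotation_apply]
  fun_prop

lemma lintegral_lintegral_rotation_stdGaussian {H : E × E → ℝ≥0∞} (hH : Measurable H) :
    ∫⁻ p, (∫⁻ θ in Set.Ioc 0 (2 * Real.pi), H (ContinuousLinearMap.rotation θ p))
        ∂(stdGaussian E).prod (stdGaussian E) =
      ENNReal.ofReal (2 * Real.pi) * ∫⁻ p, H p ∂(stdGaussian E).prod (stdGaussian E) := by
  have hinvariant (θ : ℝ) : ∫⁻ p, H (ContinuousLinearMap.rotation θ p)
      ∂(stdGaussian E).prod (stdGaussian E) = ∫⁻ p, H p ∂(stdGaussian E).prod (stdGaussian E) := by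
    rw [← lintegral_map hH (by fun_prop), IsGaussian.map_rotation_eq_self integral_id_stdGaussian]
  rw [lintegral_lintegral_swap (measurable_comp_rotation hH).aemeasurable]
  simp only [hinvariant, setLIntegral_const, Real.volume_Ioc, sub_zero, mul_comm]

/-- Two independent Gaussian vectors almost surely span a plane, and averaging over the rotations of
that plane does not change the Gaussian integral. -/
lemma lintegral_stdGaussian_prod_le_of_rotation (hdim : 1 < Module.finrank ℝ E)
    {H₁ H₂ : E × E → ℝ≥0∞} (hH₁ : Measurable H₁) (hH₂ : Measurable H₂)
    (hle : ∀ p : E × E, p.1 ≠ 0 → p.2 ∉ ℝ ∙ p.1 →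
      ∫⁻ θ in Set.Ioc 0 (2 * Real.pi), H₁ (ContinuousLinearMap.rotation θ p) ≤
        ∫⁻ θ in Set.Ioc 0 (2 * Real.pi), H₂ (ContinuousLinearMap.rotation θ p)) :
    ∫⁻ p, H₁ p ∂(stdGaussian E).prod (stdGaussian E) ≤
      ∫⁻ p, H₂ p ∂(stdGaussian E).prod (stdGaussian E) := by
  have : Nontrivial E := Module.nontrivial_of_finrank_pos (R := ℝ) (by lia)
  have hspan (x : E) : ℝ ∙ x ≠ ⊤ := (span_lt_top_of_card_lt_finrank (by simpa using hdim)).ne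
  refine (ENNReal.mul_le_mul_iff_right (a := ENNReal.ofReal (2 * Real.pi))
    (by simp [Real.pi_pos]) ENNReal.ofReal_ne_top).1 ?_
  rw [← lintegral_lintegral_rotation_stdGaussian hH₁,
    ← lintegral_lintegral_rotation_stdGaussian hH₂,
    lintegral_prod _ (measurable_comp_rotation hH₁).lintegral_prod_right'.aemeasurable,
    lintegral_prod _ (measurable_comp_rotation hH₂).lintegral_prod_right'.aemeasurable]
  refine lintegral_mono_ae ?_
  filter_upwards [ae_stdGaussian_ne_zero] with x hx
  refine lintegral_mono_ae ?_
  filter_upwards [ae_stdGaussian_notMem_of_ne_top (hspan x)] with y hy using hle (x, y) hx hy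

@[fun_prop]
lemma measurable_fderiv_apply (F : E → ℝ) : Measurable fun p : E × E => fderiv ℝ F p.1 p.2 :=
  isBoundedBilinearMap_apply.continuous.measurable.comp
    (((measurable_fderiv ℝ F).comp measurable_fst).prodMk measurable_snd)

lemma lintegral_sub_sq_stdGaussian_prod_le (hdim : 1 < Module.finrank ℝ E) {F : E → ℝ}
    (hF : ContDiffOn ℝ 1 F {0}ᶜ) :
    ∫⁻ p, ‖F p.1 - F p.2‖ₑ ^ 2 ∂(stdGaussian E).prod (stdGaussian E) ≤
      2 * ∫⁻ p, ‖fderiv ℝ F p.1 p.2‖ₑ ^ 2 ∂(stdGaussian E).prod (stdGaussian E) := by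
  have hF_meas : Measurable F := measurable_of_continuousOn_compl_singleton 0 hF.continuousOn
  rw [← lintegral_const_mul' _ _ (by simp)]
  refine lintegral_stdGaussian_prod_le_of_rotation hdim (by fun_prop) (by fun_prop) ?_
  intro p hp1 hp2
  rw [lintegral_const_mul' _ _ (by simp)]
  exact lintegral_rotation_sub_sq_le hF hp1 hp2

lemma lintegral_dual_sq_stdGaussian (L : StrongDual ℝ E) :
    ∫⁻ x, ‖L x‖ₑ ^ 2 ∂stdGaussian E = ‖L‖ₑ ^ 2 := by
  have hL := ofReal_variance (IsGaussian.memLp_dual (stdGaussian E) L 2 (by simp))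
  rw [variance_dual_stdGaussian, evariance, integral_strongDual_stdGaussian] at hL
  simpa [ENNReal.ofReal_pow, ofReal_norm] using hL.symm

lemma lintegral_sub_sq_prod {Ω : Type*} [MeasurableSpace Ω] {μ : Measure Ω} [IsProbabilityMeasure μ]
    {X : Ω → ℝ} (hX : MemLp X 2 μ) :
    ∫⁻ p, ‖X p.1 - X p.2‖ₑ ^ 2 ∂μ.prod μ = 2 * eVar[X; μ] := by
  have hmean : ∫ p, X p.1 - X p.2 ∂μ.prod μ = 0 := by
    have hint := hX.integrable one_le_two
    rw [integral_sub (hint.comp_fst μ) (hint.comp_snd μ), integral_fun_fst,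
      integral_fun_snd, sub_self]
  have hvar : Var[fun p => X p.1 - X p.2; μ.prod μ] = 2 * Var[X; μ] := by
    simpa [← sub_eq_add_neg, variance_neg, two_mul] using variance_add_prod hX hX.neg
  have hmem : MemLp (fun p : Ω × Ω => X p.1 - X p.2) 2 (μ.prod μ) :=
    (hX.comp_fst μ).sub (hX.comp_snd μ)
  calc ∫⁻ p, ‖X p.1 - X p.2‖ₑ ^ 2 ∂μ.prod μ = eVar[fun p => X p.1 - X p.2; μ.prod μ] := by
        simp only [evariance, hmean, sub_zero]
    _ = 2 * eVar[X; μ] := by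
        rw [← ofReal_variance hmem, hvar, ENNReal.ofReal_mul zero_le_two, ENNReal.ofReal_ofNat,
          ofReal_variance hX]

theorem evariance_stdGaussian_le (hdim : 1 < Module.finrank ℝ E) {F : E → ℝ}
    (hF : ContDiffOn ℝ 1 F {0}ᶜ) (hmem : MemLp F 2 (stdGaussian E)) :
    eVar[F; stdGaussian E] ≤ ∫⁻ x, ‖fderiv ℝ F x‖ₑ ^ 2 ∂stdGaussian E := by
  have h := lintegral_sub_sq_stdGaussian_prod_le hdim hF
  rw [lintegral_sub_sq_prod hmem, lintegral_prod _ (by fun_prop)] at h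
  simpa only [lintegral_dual_sq_stdGaussian,
    ENNReal.mul_le_mul_iff_right two_ne_zero ENNReal.ofNat_ne_top] using h

end GreatCircle

section Sphere

variable {n : ℕ} {R : ℝ}

lemma ne_zero_of_mem_sphere (hR : 0 < R) (z : Sph n R) : (z : Eu n) ≠ 0 :=
  ne_zero_of_norm_ne_zero (by rw [norm_eq_of_mem_sphere z]; exact hR.ne')

/-- The radial projection of `ℝⁿ ∖ {0}` onto the sphere of radius `R`; it sends `0` to `0`. -/
noncomputable def sphereProj (R : ℝ) (x : Eu n) : Eu n := (R / ‖x‖) • x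

lemma norm_sphereProj (hR : 0 < R) {x : Eu n} (hx : x ≠ 0) : ‖sphereProj R x‖ = R := by
  have : ‖x‖ ≠ 0 := norm_ne_zero_iff.2 hx
  rw [sphereProj, norm_smul, norm_div, norm_norm, Real.norm_of_nonneg hR.le]
  field_simp

@[fun_prop]
lemma measurable_sphereProj : Measurable (sphereProj R : Eu n → Eu n) := by
  unfold sphereProj; fun_prop

lemma sphereProj_smul {c : ℝ} (hc : 0 < c) (x : Eu n) : sphereProj R (c • x) = sphereProj R x := by
  rw [sphereProj, sphereProj, norm_smul, Real.norm_of_nonneg hc.le, smul_smul]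
  congr 1
  field_simp

lemma sphereProj_linearIsometryEquiv (U : Eu n ≃ₗᵢ[ℝ] Eu n) (x : Eu n) :
    sphereProj R (U x) = U (sphereProj R x) := by
  rw [sphereProj, sphereProj, U.norm_map, map_smul]

lemma continuous_comp_val (hR : 0 < R) {G : Type*} [TopologicalSpace G] {g : Eu n → G}
    (hg : ContinuousOn g {0}ᶜ) : Continuous fun z : Sph n R => g z :=
  hg.comp_continuous continuous_subtype_val fun z => ne_zero_of_mem_sphere hR z

variable [NeZero n]

lemma map_val_unifSphere (hR : 0 < R) :
    (unifSphere n R).map Subtype.val = (stdGaussian (Eu n)).map (sphereProj R) := by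
  have hms : MeasurableSet (Metric.sphere (0 : Eu n) R) := Metric.isClosed_sphere.measurableSet
  rw [unifSphere, (MeasurableEmbedding.subtype_coe hms).map_comap, Subtype.range_coe]
  refine Measure.restrict_eq_self_of_ae_mem ?_
  change ∀ᵐ x ∂((stdGaussian (Eu n)).map (sphereProj R)), x ∈ Metric.sphere (0 : Eu n) R
  refine (ae_map_iff measurable_sphereProj.aemeasurable hms).2 ?_
  filter_upwards [ae_stdGaussian_ne_zero (E := Eu n)] with x hx
  simpa using norm_sphereProj hR hx

lemma lintegral_unifSphere (hR : 0 < R) {g : Eu n → ℝ≥0∞} (hg : Measurable g) :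
    ∫⁻ z : Sph n R, g z ∂unifSphere n R = ∫⁻ x, g (sphereProj R x) ∂stdGaussian (Eu n) := by
  have hms : MeasurableSet (Metric.sphere (0 : Eu n) R) := Metric.isClosed_sphere.measurableSet
  rw [← (MeasurableEmbedding.subtype_coe hms).lintegral_map, map_val_unifSphere hR,
    lintegral_map hg (by fun_prop)]

lemma isProbabilityMeasure_unifSphere (hR : 0 < R) : IsProbabilityMeasure (unifSphere n R) :=
  ⟨by simpa using lintegral_unifSphere (n := n) hR (g := fun _ => 1) measurable_const⟩

lemma memLp_unifSphere (hR : 0 < R) {G : Type*} [NormedAddCommGroup G] {g : Eu n → G}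
    (hg : ContinuousOn g {0}ᶜ) (p : ℝ≥0∞) : MemLp (fun z : Sph n R => g z) p (unifSphere n R) := by
  have := isProbabilityMeasure_unifSphere (n := n) hR
  exact (continuous_comp_val hR hg).memLp_of_hasCompactSupport (.of_compactSpace _)

lemma integrable_unifSphere (hR : 0 < R) {G : Type*} [NormedAddCommGroup G] {g : Eu n → G}
    (hg : ContinuousOn g {0}ᶜ) : Integrable (fun z : Sph n R => g z) (unifSphere n R) :=
  memLp_one_iff_integrable.1 (memLp_unifSphere hR hg 1)

lemma integral_unifSphere (hR : 0 < R) {G : Type*} [NormedAddCommGroup G] [NormedSpace ℝ G]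
    {g : Eu n → G} (hg : StronglyMeasurable g) :
    ∫ z : Sph n R, g z ∂unifSphere n R = ∫ x, g (sphereProj R x) ∂stdGaussian (Eu n) := by
  have hms : MeasurableSet (Metric.sphere (0 : Eu n) R) := Metric.isClosed_sphere.measurableSet
  rw [← (MeasurableEmbedding.subtype_coe hms).integral_map, map_val_unifSphere hR,
    integral_map (by fun_prop) hg.aestronglyMeasurable]

lemma integral_comp_linearIsometryEquiv (hR : 0 < R) (U : Eu n ≃ₗᵢ[ℝ] Eu n) {G : Type*}
    [NormedAddCommGroup G] [NormedSpace ℝ G] {g : Eu n → G} (hg : StronglyMeasurable g) :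
    ∫ z : Sph n R, g (U z) ∂unifSphere n R = ∫ z : Sph n R, g z ∂unifSphere n R := by
  calc ∫ z : Sph n R, g (U z) ∂unifSphere n R
    _ = ∫ x, g (U (sphereProj R x)) ∂stdGaussian (Eu n) :=
      integral_unifSphere hR (g := fun x => g (U x)) (hg.comp_measurable U.continuous.measurable)
    _ = ∫ x, g (sphereProj R x) ∂(stdGaussian (Eu n)).map U := by
      simp_rw [← sphereProj_linearIsometryEquiv]
      exact (integral_map U.continuous.aemeasurable
        (hg.comp_measurable measurable_sphereProj).aestronglyMeasurable).symm
    _ = ∫ z : Sph n R, g z ∂unifSphere n R := by rw [stdGaussian_map, integral_unifSphere hR hg]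

end Sphere

section Rotation

variable {n : ℕ} {R : ℝ}

lemma hasDerivAt_comp_exp_smul {E : Type*} [NormedAddCommGroup E] [NormedSpace ℝ E]
    [CompleteSpace E] (A : E →L[ℝ] E) {g : E → ℝ} {t : ℝ} {x : E}
    (hg : DifferentiableAt ℝ g (NormedSpace.exp (t • A) x)) :
    HasDerivAt (fun s : ℝ => g (NormedSpace.exp (s • A) x))
      (fderiv ℝ g (NormedSpace.exp (t • A) x) (A (NormedSpace.exp (t • A) x))) t :=
  hg.hasFDerivAt.comp_hasDerivAt t
    ((hasDerivAt_exp_smul_const' A t).clm_apply (hasDerivAt_const t x) |>.congr_deriv (by simp))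

/-- The linear isometry `exp (t • A)` generated by a skew-adjoint operator `A`. -/
noncomputable def expIsometry {E : Type*} [NormedAddCommGroup E] [InnerProductSpace ℝ E]
    [CompleteSpace E] {A : E →L[ℝ] E} (hA : A ∈ skewAdjoint (E →L[ℝ] E)) (t : ℝ) : E ≃ₗᵢ[ℝ] E :=
  letI : NormedAlgebra ℚ (E →L[ℝ] E) := NormedAlgebra.restrictScalars ℚ ℝ _
  Unitary.linearIsometryEquiv ⟨NormedSpace.exp (t • A),
    NormedSpace.exp_mem_unitary_of_mem_skewAdjoint (skewAdjoint.smul_mem t hA)⟩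

lemma expIsometry_zero {E : Type*} [NormedAddCommGroup E] [InnerProductSpace ℝ E]
    [CompleteSpace E] {A : E →L[ℝ] E} (hA : A ∈ skewAdjoint (E →L[ℝ] E)) (x : E) :
    expIsometry hA 0 x = x := by
  change NormedSpace.exp ((0 : ℝ) • A) x = x
  rw [zero_smul, NormedSpace.exp_zero, one_apply_eq_self]

/-- The rotations `exp (t • A)` preserve `∫ g`, whose derivative at `t = 0` is this integral. -/
lemma integral_fderiv_skewAdjoint [NeZero n] (hR : 0 < R) {A : Eu n →L[ℝ] Eu n}
    (hA : A ∈ skewAdjoint (Eu n →L[ℝ] Eu n)) {g : Eu n → ℝ} (hg : ContDiffOn ℝ 1 g {0}ᶜ) :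
    ∫ z : Sph n R, fderiv ℝ g z (A z) ∂unifSphere n R = 0 := by
  have hprob := isProbabilityMeasure_unifSphere (n := n) hR
  let U (t : ℝ) : Eu n ≃ₗᵢ[ℝ] Eu n := expIsometry hA t
  have hU0 (x : Eu n) : U 0 x = x := expIsometry_zero hA x
  have hUz (t : ℝ) (z : Sph n R) : U t z ∈ Metric.sphere (0 : Eu n) R := by simp
  have hcomp {f : Eu n → ℝ} (hf : ContinuousOn f {0}ᶜ) (t : ℝ) :
      ContinuousOn (fun x => f (U t x)) {0}ᶜ :=
    hf.comp (U t).continuous.continuousOn fun x hx => by simpa using hx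
  have hfderiv : ContinuousOn (fun x => fderiv ℝ g x (A x)) {0}ᶜ :=
    (continuousOn_fderiv_of_contDiffOn_compl_zero hg).clm_apply A.continuous.continuousOn
  obtain ⟨C, hC⟩ := isCompact_univ.exists_bound_of_continuousOn
    (continuous_comp_val hR hfderiv).continuousOn
  have hconst (t : ℝ) :
      ∫ z : Sph n R, g (U t z) ∂unifSphere n R = ∫ z : Sph n R, g z ∂unifSphere n R :=
    integral_comp_linearIsometryEquiv hR (U t)
      (measurable_of_continuousOn_compl_singleton 0 hg.continuousOn).stronglyMeasurable
  have hderiv := (hasDerivAt_integral_of_dominated_loc_of_deriv_le (μ := unifSphere n R)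
    (F := fun t z => g (U t z)) (F' := fun t z => fderiv ℝ g (U t z) (A (U t z))) (x₀ := 0)
    (bound := fun _ => C) Filter.univ_mem
    (.of_forall fun t => (continuous_comp_val hR (hcomp hg.continuousOn t)).aestronglyMeasurable)
    (integrable_unifSphere hR (hcomp hg.continuousOn 0))
    (continuous_comp_val hR (hcomp hfderiv 0)).aestronglyMeasurable
    (.of_forall fun z t _ => hC ⟨U t z, hUz t z⟩ (Set.mem_univ _)) (integrable_const C)
    (.of_forall fun z t _ => hasDerivAt_comp_exp_smul A <|
      differentiableAt_of_contDiffOn_compl_zero hg (ne_zero_of_mem_sphere hR ⟨U t z, hUz t z⟩))).2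
  simp only [hconst, hU0] at hderiv
  exact hderiv.unique (hasDerivAt_const 0 _)

end Rotation

section IntegrationByParts

variable {n : ℕ} {R : ℝ}

section Basis

variable {E ι : Type*} [NormedAddCommGroup E] [InnerProductSpace ℝ E] [Fintype ι]

lemma sum_inner_mul_clm_tangential (b : OrthonormalBasis ι ℝ E) (ℓ : StrongDual ℝ E) (a x : E) :
    ∑ j, inner ℝ (b j) x * ℓ (inner ℝ (b j) x • a - inner ℝ a x • b j) =
      ‖x‖ ^ 2 * ℓ a - inner ℝ a x * ℓ x := by
  have hℓ : ∑ j, inner ℝ (b j) x * ℓ (b j) = ℓ x := by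
    rw [← congrArg ℓ (b.sum_repr' x)]
    simp only [map_sum, map_smul, smul_eq_mul]
  have hnorm : ∑ j, inner ℝ (b j) x ^ 2 = ‖x‖ ^ 2 := by
    simpa using b.sum_sq_norm_inner_right x
  rw [← hℓ, ← hnorm, Finset.mul_sum, Finset.sum_mul, ← Finset.sum_sub_distrib]
  refine Finset.sum_congr rfl fun j _ => ?_
  simp only [map_sub, map_smul, smul_eq_mul]
  ring

lemma sum_inner_tangential (b : OrthonormalBasis ι ℝ E) (a x : E) :
    ∑ j, inner ℝ (b j) (inner ℝ (b j) x • a - inner ℝ a x • b j) =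
      (1 - Fintype.card ι) * inner ℝ a x := by
  have hinner : ∑ j, inner ℝ (b j) x * inner ℝ (b j) a = inner ℝ a x := by
    rw [← b.sum_inner_mul_inner a x]
    exact Finset.sum_congr rfl fun j _ => by rw [mul_comm, real_inner_comm]
  simp only [inner_sub_right, inner_smul_right, real_inner_self_eq_norm_sq, b.norm_eq_one,
    Finset.sum_sub_distrib, hinner, Finset.sum_const, Finset.card_univ, nsmul_eq_mul]
  ring

end Basis

variable [NeZero n]

/-- Rotation invariance for the generators `x ↦ ⟪bⱼ, x⟫ a - ⟪a, x⟫ bⱼ` and the functions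
`⟪bⱼ, ·⟫ g`, summed over an orthonormal basis `b`. -/
lemma integral_fderiv_tangential (hR : 0 < R) {g : Eu n → ℝ} (hg : ContDiffOn ℝ 1 g {0}ᶜ)
    (a : Eu n) :
    ∫ z : Sph n R, (R ^ 2 * fderiv ℝ g z a - inner ℝ a (z : Eu n) * fderiv ℝ g z z
      - (n - 1) * (inner ℝ a (z : Eu n) * g z)) ∂unifSphere n R = 0 := by
  let b := EuclideanSpace.basisFun (Fin n) ℝ
  let A (j : Fin n) : Eu n →L[ℝ] Eu n :=
    InnerProductSpace.rankOne ℝ a (b j) - InnerProductSpace.rankOne ℝ (b j) a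
  have hA (j : Fin n) : A j ∈ skewAdjoint (Eu n →L[ℝ] Eu n) := by
    simp [A, skewAdjoint.mem_iff, ContinuousLinearMap.star_eq_adjoint]
  have hAx (j : Fin n) (x : Eu n) : A j x = inner ℝ (b j) x • a - inner ℝ a x • b j := rfl
  let G (j : Fin n) (x : Eu n) : ℝ := inner ℝ (b j) x * g x
  have hG (j : Fin n) : ContDiffOn ℝ 1 (G j) {0}ᶜ :=
    (contDiff_const.inner ℝ contDiff_id).contDiffOn.mul hg
  have hsum (z : Sph n R) : ∑ j, fderiv ℝ (G j) z (A j z) =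
      R ^ 2 * fderiv ℝ g z a - inner ℝ a (z : Eu n) * fderiv ℝ g z z
        - (n - 1) * (inner ℝ a (z : Eu n) * g z) := by
    have hterm (j : Fin n) : fderiv ℝ (G j) z (A j z) =
        inner ℝ (b j) (z : Eu n) * fderiv ℝ g z (A j z) + inner ℝ (b j) (A j z) * g z := by
      have hgz := differentiableAt_of_contDiffOn_compl_zero hg (ne_zero_of_mem_sphere hR z)
      have hGj := ((innerSL ℝ (b j)).hasFDerivAt.mul hgz.hasFDerivAt).fderiv
      refine (congrArg (· (A j z)) hGj).trans ?_
      simp [mul_comm]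
    simp_rw [hterm, hAx]
    rw [Finset.sum_add_distrib, ← Finset.sum_mul, sum_inner_mul_clm_tangential,
      sum_inner_tangential, norm_eq_of_mem_sphere z, Fintype.card_fin]
    ring
  simp_rw [← hsum]
  rw [integral_finsetSum _ fun j _ => integrable_unifSphere hR <|
    (continuousOn_fderiv_of_contDiffOn_compl_zero (hG j)).clm_apply (A j).continuous.continuousOn]
  exact Finset.sum_eq_zero fun j _ => integral_fderiv_skewAdjoint hR (hA j) (hG j)

end IntegrationByParts

section Divergence

variable {E : Type*} [NormedAddCommGroup E] [NormedSpace ℝ E] [FiniteDimensional ℝ E]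

variable (E) in
/-- The trace as a continuous linear form on the operators of a finite-dimensional space. -/
noncomputable def traceCLM : (E →L[ℝ] E) →L[ℝ] ℝ :=
  (LinearMap.trace ℝ E ∘ₗ ContinuousLinearMap.coeLM ℝ).toContinuousLinearMap

lemma traceCLM_apply (L : E →L[ℝ] E) : traceCLM E L = LinearMap.trace ℝ E L := rfl

lemma traceCLM_smulRight (ℓ : StrongDual ℝ E) (v : E) : traceCLM E (ℓ.smulRight v) = ℓ v :=
  LinearMap.trace_smulRight _ _

/-- The divergence of a vector field. -/
noncomputable def divergence (V : E → E) (x : E) : ℝ := traceCLM E (fderiv ℝ V x)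

lemma IsPosHomogeneous.divergence {V : E → E} {d : ℤ} (hV : IsPosHomogeneous d V) :
    IsPosHomogeneous (d - 1) (divergence V) :=
  hV.fderiv.clm_comp (traceCLM E : (E →L[ℝ] E) →ₗ[ℝ] ℝ)

lemma divergence_smul {φ : E → ℝ} {V : E → E} {x : E} (hφ : DifferentiableAt ℝ φ x)
    (hV : DifferentiableAt ℝ V x) :
    divergence (fun y => φ y • V y) x = φ x * divergence V x + fderiv ℝ φ x (V x) := by
  rw [divergence, fderiv_fun_smul hφ hV, map_add, map_smul, smul_eq_mul, traceCLM_smulRight,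
    divergence]

lemma divergence_sub {V W : E → E} {x : E} (hV : DifferentiableAt ℝ V x)
    (hW : DifferentiableAt ℝ W x) :
    divergence (fun y => V y - W y) x = divergence V x - divergence W x := by
  simp only [divergence, fderiv_fun_sub hV hW, map_sub]

variable {F : E → E} {x : E}

lemma hasFDerivAt_divergence (hF : ContDiffAt ℝ 2 F x) :
    HasFDerivAt (divergence F) (traceCLM E ∘L fderiv ℝ (fderiv ℝ F) x) x :=
  (traceCLM E).hasFDerivAt.comp x
    ((hF.fderiv_right (m := 1) le_rfl).differentiableAt one_ne_zero).hasFDerivAt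

/-- Uses the symmetry of the second derivative. -/
lemma divergence_fderiv_apply_self (hF : ContDiffAt ℝ 2 F x) :
    divergence (fun y => fderiv ℝ F y (F y)) x =
      traceCLM E (fderiv ℝ F x ∘L fderiv ℝ F x) + fderiv ℝ (divergence F) x (F x) := by
  have hDF : DifferentiableAt ℝ (fderiv ℝ F) x :=
    (hF.fderiv_right (m := 1) le_rfl).differentiableAt one_ne_zero
  have hsymm : (fderiv ℝ (fderiv ℝ F) x).flip (F x) = fderiv ℝ (fderiv ℝ F) x (F x) := by
    ext v
    exact hF.isSymmSndFDerivAt (by simp) v (F x)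
  rw [divergence, fderiv_clm_apply hDF (hF.differentiableAt two_ne_zero), map_add, hsymm,
    (hasFDerivAt_divergence hF).fderiv]
  rfl

lemma divergence_divergence_smul_sub (hF : ContDiffAt ℝ 2 F x) :
    divergence (fun y => divergence F y • F y - fderiv ℝ F y (F y)) x =
      divergence F x ^ 2 - traceCLM E (fderiv ℝ F x ∘L fderiv ℝ F x) := by
  have hdiff := hF.differentiableAt two_ne_zero
  have hdiv := (hasFDerivAt_divergence hF).differentiableAt
  have hDF : DifferentiableAt ℝ (fderiv ℝ F) x :=
    (hF.fderiv_right (m := 1) le_rfl).differentiableAt one_ne_zero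
  rw [divergence_sub (hdiv.fun_smul hdiff) (hDF.clm_apply hdiff), divergence_smul hdiv hdiff,
    divergence_fderiv_apply_self hF]
  ring

end Divergence

section SecondOrder

lemma continuousOn_divergence {E : Type*} [NormedAddCommGroup E] [NormedSpace ℝ E]
    [FiniteDimensional ℝ E] {V : E → E} (hV : ContDiffOn ℝ 1 V {0}ᶜ) :
    ContinuousOn (divergence V) {0}ᶜ :=
  (traceCLM E).continuous.comp_continuousOn (continuousOn_fderiv_of_contDiffOn_compl_zero hV)

variable {n : ℕ} {R : ℝ} [NeZero n]

lemma integral_inner_eq_integral_divergence (hR : 0 < R) {d : ℤ} {V : Eu n → Eu n}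
    (hV : ContDiffOn ℝ 1 V {0}ᶜ) (hhom : IsPosHomogeneous d V) :
    (n - 1 + d) * ∫ z : Sph n R, inner ℝ (z : Eu n) (V z) ∂unifSphere n R =
      R ^ 2 * ∫ z : Sph n R, divergence V z ∂unifSphere n R := by
  let b := EuclideanSpace.basisFun (Fin n) ℝ
  have hcoord (i : Fin n) (z : Sph n R) (v : Eu n) :
      fderiv ℝ (fun x => inner ℝ (b i) (V x)) z v = inner ℝ (b i) (fderiv ℝ V z v) := by
    have hVz := differentiableAt_of_contDiffOn_compl_zero hV (ne_zero_of_mem_sphere hR z)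
    exact congrArg (· v) ((innerSL ℝ (b i)).hasFDerivAt.comp (z : Eu n) hVz.hasFDerivAt).fderiv
  have hsum (z : Sph n R) : ∑ i, (R ^ 2 * fderiv ℝ (fun x => inner ℝ (b i) (V x)) z (b i)
        - inner ℝ (b i) (z : Eu n) * fderiv ℝ (fun x => inner ℝ (b i) (V x)) z z
        - (n - 1) * (inner ℝ (b i) (z : Eu n) * inner ℝ (b i) (V z))) =
      R ^ 2 * divergence V z - (n - 1 + d) * inner ℝ (z : Eu n) (V z) := by
    have hparseval (v : Eu n) : ∑ i, inner ℝ (b i) (z : Eu n) * inner ℝ (b i) v =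
        inner ℝ (z : Eu n) v := by
      simp_rw [← b.sum_inner_mul_inner (z : Eu n) v, real_inner_comm (b _) (z : Eu n)]
    have heuler := hhom.fderiv_apply_self
      (differentiableAt_of_contDiffOn_compl_zero hV (ne_zero_of_mem_sphere hR z))
    simp_rw [hcoord, Finset.sum_sub_distrib, ← Finset.mul_sum, hparseval, heuler,
      inner_smul_right, divergence, traceCLM_apply, LinearMap.trace_eq_sum_inner _ b]
    simp only [ContinuousLinearMap.coe_coe]
    ring
  have hVb (i : Fin n) : ContDiffOn ℝ 1 (fun x => inner ℝ (b i) (V x)) {0}ᶜ :=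
    contDiffOn_const.inner ℝ hV
  have hzero : ∫ z : Sph n R, (R ^ 2 * divergence V z
      - (n - 1 + d) * inner ℝ (z : Eu n) (V z)) ∂unifSphere n R = 0 := by
    simp_rw [← hsum]
    refine (integral_finsetSum Finset.univ fun i _ => integrable_unifSphere hR
      (g := fun x => R ^ 2 * fderiv ℝ (fun x => inner ℝ (b i) (V x)) x (b i)
        - inner ℝ (b i) x * fderiv ℝ (fun x => inner ℝ (b i) (V x)) x x
        - (n - 1) * (inner ℝ (b i) x * inner ℝ (b i) (V x))) ?_).trans
      (Finset.sum_eq_zero fun i _ => integral_fderiv_tangential hR (hVb i) (b i))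
    have hfderiv := continuousOn_fderiv_of_contDiffOn_compl_zero (hVb i)
    have hVi := (hVb i).continuousOn
    fun_prop
  have hinner : ContinuousOn (fun x : Eu n => inner ℝ x (V x)) {0}ᶜ :=
    continuousOn_id.inner hV.continuousOn
  rw [integral_sub ((integrable_unifSphere hR (continuousOn_divergence hV)).const_mul _)
    ((integrable_unifSphere hR hinner).const_mul _), integral_const_mul, integral_const_mul]
    at hzero
  linarith

/-- Integration by parts for the field `⟪x, F⟫ F`, of degree `1`. -/
lemma integral_inner_sq (hR : 0 < R) {F : Eu n → Eu n} (hF : ContDiffOn ℝ 1 F {0}ᶜ)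
    (hhom : IsPosHomogeneous 0 F) :
    n * ∫ z : Sph n R, inner ℝ (z : Eu n) (F z) ^ 2 ∂unifSphere n R =
      R ^ 2 * ∫ z : Sph n R, (inner ℝ (z : Eu n) (F z) * divergence F z + ‖F z‖ ^ 2
        + inner ℝ (z : Eu n) (fderiv ℝ F z (F z))) ∂unifSphere n R := by
  let φ (x : Eu n) : ℝ := inner ℝ x (F x)
  have hφ : ContDiffOn ℝ 1 φ {0}ᶜ := contDiffOn_id.inner ℝ hF
  have hφhom : IsPosHomogeneous 1 φ := fun c hc x => by
    simp [φ, inner_smul_left, hhom hc x]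
  have hφF := integral_inner_eq_integral_divergence hR (hφ.fun_smul hF) (hφhom.smul hhom)
  have hleft (z : Sph n R) : inner ℝ (z : Eu n) (φ z • F z) = inner ℝ (z : Eu n) (F z) ^ 2 := by
    rw [inner_smul_right, ← pow_two]
  have hright (z : Sph n R) : divergence (fun x => φ x • F x) z =
      inner ℝ (z : Eu n) (F z) * divergence F z + ‖F z‖ ^ 2
        + inner ℝ (z : Eu n) (fderiv ℝ F z (F z)) := by
    have hFz := differentiableAt_of_contDiffOn_compl_zero hF (ne_zero_of_mem_sphere hR z)
    have hφz := differentiableAt_of_contDiffOn_compl_zero hφ (ne_zero_of_mem_sphere hR z)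
    rw [divergence_smul hφz hFz, fderiv_inner_apply ℝ differentiableAt_fun_id hFz, fderiv_fun_id,
      ContinuousLinearMap.id_apply, real_inner_self_eq_norm_sq]
    ring
  rw [integral_congr_ae (.of_forall hleft), integral_congr_ae (.of_forall hright)] at hφF
  rw [← hφF]
  push_cast
  ring

/-- Integration by parts for the field `(div F) F - DF F`, of degree `-1`. -/
lemma integral_inner_mul_divergence_sub (hR : 0 < R) {F : Eu n → Eu n}
    (hF : ContDiffOn ℝ 2 F {0}ᶜ) (hhom : IsPosHomogeneous 0 F) :
    (n - 2) * ∫ z : Sph n R, (inner ℝ (z : Eu n) (F z) * divergence F z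
        - inner ℝ (z : Eu n) (fderiv ℝ F z (F z))) ∂unifSphere n R =
      R ^ 2 * ∫ z : Sph n R, (divergence F z ^ 2
        - traceCLM _ (fderiv ℝ F z ∘L fderiv ℝ F z)) ∂unifSphere n R := by
  have hF1 := hF.of_le one_le_two
  have hDF : ContDiffOn ℝ 1 (fderiv ℝ F) {0}ᶜ :=
    hF.fderiv_of_isOpen isOpen_compl_singleton le_rfl
  have hV : ContDiffOn ℝ 1 (fun x => divergence F x • F x - fderiv ℝ F x (F x)) {0}ᶜ :=
    (((traceCLM (Eu n)).contDiff.comp_contDiffOn hDF).smul hF1).sub (hDF.clm_apply hF1)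
  have hVhom := (hhom.divergence.smul hhom).sub (hhom.fderiv.clm_apply hhom)
  have hdiv := integral_inner_eq_integral_divergence hR hV hVhom
  have hleft (z : Sph n R) :
      inner ℝ (z : Eu n) (divergence F z • F z - fderiv ℝ F z (F z)) =
        inner ℝ (z : Eu n) (F z) * divergence F z - inner ℝ (z : Eu n) (fderiv ℝ F z (F z)) := by
    rw [inner_sub_right, inner_smul_right, mul_comm]
  have hright (z : Sph n R) := divergence_divergence_smul_sub
    (hF.contDiffAt (isOpen_compl_singleton.mem_nhds (ne_zero_of_mem_sphere hR z)))
  simp only [hleft, hright] at hdiv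
  rw [← hdiv]
  push_cast
  ring

/-- The term `⟪x, DF F⟫` cancels between `integral_inner_sq` and
`integral_inner_mul_divergence_sub`. -/
lemma integral_inner_sub_divergence_sq (hR : 0 < R) (hn : n ≠ 2) {F : Eu n → Eu n}
    (hF : ContDiffOn ℝ 2 F {0}ᶜ) (hhom : IsPosHomogeneous 0 F) :
    ∫ z : Sph n R, (n * (R ^ 2)⁻¹ * inner ℝ (z : Eu n) (F z) - divergence F z) ^ 2 ∂unifSphere n R =
      n * (R ^ 2)⁻¹ * ∫ z : Sph n R, ‖F z‖ ^ 2 ∂unifSphere n R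
        + n * ((n : ℝ) - 2)⁻¹ *
          ∫ z : Sph n R, traceCLM _ (fderiv ℝ F z ∘L fderiv ℝ F z) ∂unifSphere n R
        - 2 * ((n : ℝ) - 2)⁻¹ * ∫ z : Sph n R, divergence F z ^ 2 ∂unifSphere n R := by
  have hn2 : (n : ℝ) - 2 ≠ 0 := sub_ne_zero.2 (by exact_mod_cast hn)
  have hF1 := hF.of_le one_le_two
  have hDF := continuousOn_fderiv_of_contDiffOn_compl_zero hF1
  have hdiv := continuousOn_divergence hF1
  have hFc := hF.continuousOn
  have iφ2 := integrable_unifSphere hR (g := fun x => inner ℝ x (F x) ^ 2) (by fun_prop)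
  have iφdiv := integrable_unifSphere hR (g := fun x => inner ℝ x (F x) * divergence F x)
    (by fun_prop)
  have iF := integrable_unifSphere hR (g := fun x => ‖F x‖ ^ 2) (by fun_prop)
  have iDF := integrable_unifSphere hR (g := fun x => inner ℝ x (fderiv ℝ F x (F x)))
    (by fun_prop)
  have idiv := integrable_unifSphere hR (g := fun x => divergence F x ^ 2) (by fun_prop)
  have itrace := integrable_unifSphere hR
    (g := fun x => traceCLM _ (fderiv ℝ F x ∘L fderiv ℝ F x)) (by fun_prop)
  have hsq := integral_inner_sq hR hF1 hhom
  have hdiv_sub := integral_inner_mul_divergence_sub hR hF hhom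
  rw [integral_add (iφdiv.fun_add iF) iDF, integral_add iφdiv iF] at hsq
  rw [integral_sub iφdiv iDF, integral_sub idiv itrace] at hdiv_sub
  have hexpand (z : Sph n R) : (n * (R ^ 2)⁻¹ * inner ℝ (z : Eu n) (F z) - divergence F z) ^ 2 =
      (n * (R ^ 2)⁻¹) ^ 2 * inner ℝ (z : Eu n) (F z) ^ 2
        + divergence F z ^ 2
        - 2 * (n * (R ^ 2)⁻¹) * (inner ℝ (z : Eu n) (F z) * divergence F z) := by ring
  simp only [hexpand]
  rw [integral_sub ((iφ2.const_mul _).fun_add idiv) (iφdiv.const_mul _),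
    integral_add (iφ2.const_mul _) idiv, integral_const_mul, integral_const_mul]
  have hR' := hR.ne'
  field_simp
  linear_combination (n - 2) * n * hsq - n * R ^ 2 * hdiv_sub

end SecondOrder

section SpherePoincare

variable {n : ℕ} {R : ℝ}

lemma IsPosHomogeneous.apply_sphereProj {G : Type*} [NormedAddCommGroup G] [NormedSpace ℝ G]
    {F : Eu n → G} (hhom : IsPosHomogeneous 0 F) (hR : 0 < R) (x : Eu n) :
    F (sphereProj R x) = F x := by
  rcases eq_or_ne x 0 with rfl | hx
  · simp [sphereProj]
  · simpa [sphereProj] using hhom (div_pos hR (norm_pos_iff.2 hx)) x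

lemma enorm_fderiv_sq_eq_sphereProj (hR : 0 < R) {F : Eu n → ℝ} (hhom : IsPosHomogeneous 0 F)
    {x : Eu n} (hx : x ≠ 0) :
    ‖fderiv ℝ F x‖ₑ ^ 2 = ENNReal.ofReal (R ^ 2) *
      (ENNReal.ofReal (‖x‖ ^ 2)⁻¹ * ‖fderiv ℝ F (sphereProj R x)‖ₑ ^ 2) := by
  have hx' := norm_pos_iff.2 hx
  have hscale := hhom.fderiv (div_pos hR hx') x
  rw [sphereProj, hscale, enorm_smul, mul_pow, ← mul_assoc, ← mul_assoc,
    ← ENNReal.ofReal_mul (by positivity), ← enorm_pow, Real.enorm_of_nonneg (by positivity),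
    ← ENNReal.ofReal_mul (by positivity)]
  have hone : R ^ 2 * (‖x‖ ^ 2)⁻¹ * ((R / ‖x‖) ^ (0 - 1 : ℤ)) ^ 2 = 1 := by
    rw [zero_sub, zpow_neg_one]
    field_simp
  rw [hone, ENNReal.ofReal_one, one_mul]

variable [NeZero n]

lemma identDistrib_comp_val (hR : 0 < R) {F : Eu n → ℝ} (hF : Measurable F)
    (hhom : IsPosHomogeneous 0 F) :
    IdentDistrib (fun z : Sph n R => F z) F (unifSphere n R) (stdGaussian (Eu n)) where
  aemeasurable_fst := (hF.comp measurable_subtype_coe).aemeasurable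
  aemeasurable_snd := hF.aemeasurable
  map_eq := by
    have hproj : F ∘ sphereProj R = F := funext (hhom.apply_sphereProj hR)
    calc (unifSphere n R).map (F ∘ Subtype.val)
      _ = ((unifSphere n R).map Subtype.val).map F :=
        (Measure.map_map hF measurable_subtype_coe).symm
      _ = (stdGaussian (Eu n)).map (F ∘ sphereProj R) := by
        rw [map_val_unifSphere hR, Measure.map_map hF measurable_sphereProj]
      _ = (stdGaussian (Eu n)).map F := by rw [hproj]

lemma lintegral_enorm_fderiv_sq_stdGaussian (hR : 0 < R) (hn : 3 ≤ n) {F : Eu n → ℝ}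
    (hhom : IsPosHomogeneous 0 F) :
    ∫⁻ x, ‖fderiv ℝ F x‖ₑ ^ 2 ∂stdGaussian (Eu n) =
      ENNReal.ofReal (R ^ 2 * ((n : ℝ) - 2)⁻¹) *
        ∫⁻ z : Sph n R, ‖fderiv ℝ F z‖ₑ ^ 2 ∂unifSphere n R := by
  have hmeas : Measurable fun x : Eu n => ‖fderiv ℝ F x‖ₑ ^ 2 :=
    (measurable_fderiv ℝ F).enorm.pow_const 2
  have hdegree : ∀ ⦃c : ℝ⦄, 0 < c → ∀ x : Eu n,
      ‖fderiv ℝ F (sphereProj R (c • x))‖ₑ ^ 2 = ‖fderiv ℝ F (sphereProj R x)‖ₑ ^ 2 :=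
    fun c hc x => by rw [sphereProj_smul hc]
  have hsplit : ∀ᵐ x ∂stdGaussian (Eu n), ‖fderiv ℝ F x‖ₑ ^ 2 = ENNReal.ofReal (R ^ 2) *
      (ENNReal.ofReal (‖x‖ ^ 2)⁻¹ * ‖fderiv ℝ F (sphereProj R x)‖ₑ ^ 2) :=
    ae_stdGaussian_ne_zero.mono fun x hx => enorm_fderiv_sq_eq_sphereProj hR hhom hx
  rw [lintegral_congr_ae hsplit, lintegral_const_mul' _ _ ENNReal.ofReal_ne_top,
    lintegral_inv_norm_sq_mul_stdGaussian (q := fun x => ‖fderiv ℝ F (sphereProj R x)‖ₑ ^ 2)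
      (by simpa using hn) (hmeas.comp measurable_sphereProj) hdegree,
    lintegral_unifSphere hR hmeas, finrank_euclideanSpace_fin, ← mul_assoc,
    ← ENNReal.ofReal_mul (by positivity)]

lemma variance_unifSphere_le (hR : 0 < R) (hn : 3 ≤ n) {F : Eu n → ℝ}
    (hF : ContDiffOn ℝ 1 F {0}ᶜ) (hhom : IsPosHomogeneous 0 F) :
    Var[fun z : Sph n R => F z; unifSphere n R] ≤
      R ^ 2 * ((n : ℝ) - 2)⁻¹ * ∫ z : Sph n R, ‖fderiv ℝ F z‖ ^ 2 ∂unifSphere n R := by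
  have hprob := isProbabilityMeasure_unifSphere (n := n) hR
  have hn' : (3 : ℝ) ≤ n := by exact_mod_cast hn
  have hident := identDistrib_comp_val hR
    (measurable_of_continuousOn_compl_singleton 0 hF.continuousOn) hhom
  have hmem := memLp_unifSphere hR hF.continuousOn 2
  have hgauss := evariance_stdGaussian_le (by simp; omega) hF (hident.memLp_iff.1 hmem)
  have hint := integrable_unifSphere hR (g := fun x => ‖fderiv ℝ F x‖ ^ 2)
    ((continuousOn_fderiv_of_contDiffOn_compl_zero hF).norm.pow 2)
  have hcoeff : 0 ≤ R ^ 2 * ((n : ℝ) - 2)⁻¹ :=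
    mul_nonneg (sq_nonneg R) (inv_nonneg.2 (by linarith))
  have hlintegral : ∫⁻ z : Sph n R, ‖fderiv ℝ F z‖ₑ ^ 2 ∂unifSphere n R =
      ENNReal.ofReal (∫ z : Sph n R, ‖fderiv ℝ F z‖ ^ 2 ∂unifSphere n R) := by
    rw [ofReal_integral_eq_lintegral_ofReal hint (ae_of_all _ fun z => by positivity)]
    simp only [ENNReal.ofReal_pow (norm_nonneg _), ofReal_norm]
  rw [← hident.evariance_eq, ← ofReal_variance hmem,
    lintegral_enorm_fderiv_sq_stdGaussian hR hn hhom, hlintegral, ← ENNReal.ofReal_mul hcoeff,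
    ENNReal.ofReal_le_ofReal_iff (mul_nonneg hcoeff (integral_nonneg fun z => by positivity))]
    at hgauss
  exact hgauss

end SpherePoincare

section LpContinuity

variable {S X : Type*} [MeasurableSpace S] [TopologicalSpace X] {σ : Measure S}
  {p q r : ℝ≥0∞} [Fact (1 ≤ p)] [Fact (1 ≤ q)] [Fact (1 ≤ r)] {u v : X → S → ℝ}

/-- The family `u x : S → ℝ` represents a continuous family of elements of `L^p(σ)`, with no choice
of representatives imposed. Density arguments in `L^p` reduce to it. -/
def LpContinuous (p : ℝ≥0∞) [Fact (1 ≤ p)] (σ : Measure S) (u : X → S → ℝ) : Prop :=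
  ∃ T : X → Lp ℝ p σ, Continuous T ∧ ∀ x, T x =ᵐ[σ] u x

namespace LpContinuous

lemma of_memLp {b : S → ℝ} (hb : MemLp b p σ) : LpContinuous p σ fun _ : X => b :=
  ⟨fun _ => hb.toLp, continuous_const, fun _ => hb.coeFn_toLp⟩

lemma of_continuous [IsFiniteMeasure σ] {c : X → ℝ} (hc : Continuous c) :
    LpContinuous p σ fun x (_ : S) => c x :=
  ⟨fun x => Lp.constL p σ ℝ (c x), (Lp.constL p σ ℝ).continuous.comp hc,
    fun _ => Lp.coeFn_const ..⟩

lemma fun_add (hu : LpContinuous p σ u) (hv : LpContinuous p σ v) :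
    LpContinuous p σ fun x z => u x z + v x z := by
  obtain ⟨T, hT, hTu⟩ := hu
  obtain ⟨U, hU, hUv⟩ := hv
  exact ⟨fun x => T x + U x, hT.add hU,
    fun x => (Lp.coeFn_add _ _).trans ((hTu x).add (hUv x))⟩

lemma fun_sub (hu : LpContinuous p σ u) (hv : LpContinuous p σ v) :
    LpContinuous p σ fun x z => u x z - v x z := by
  obtain ⟨T, hT, hTu⟩ := hu
  obtain ⟨U, hU, hUv⟩ := hv
  exact ⟨fun x => T x - U x, hT.sub hU,
    fun x => (Lp.coeFn_sub _ _).trans ((hTu x).sub (hUv x))⟩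

lemma fun_sum {ι : Type*} (s : Finset ι) {u : ι → X → S → ℝ} (hu : ∀ i, LpContinuous p σ (u i)) :
    LpContinuous p σ fun x z => ∑ i ∈ s, u i x z := by
  classical
  induction s using Finset.induction_on with
  | empty => exact of_memLp MemLp.zero
  | insert i s hi ih =>
    simp only [Finset.sum_insert hi]
    exact (hu i).fun_add ih

lemma fun_mul [ENNReal.HolderTriple p q r] (hu : LpContinuous p σ u) (hv : LpContinuous q σ v) :
    LpContinuous r σ fun x z => u x z * v x z := by
  obtain ⟨T, hT, hTu⟩ := hu
  obtain ⟨U, hU, hUv⟩ := hv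
  let B := (ContinuousLinearMap.mul ℝ ℝ).holderL σ p q r
  refine ⟨fun x => B (T x) (U x), (B.continuous.comp hT).clm_apply hU, fun x => ?_⟩
  exact ((ContinuousLinearMap.mul ℝ ℝ).coeFn_holder _ _).trans ((hTu x).mul (hUv x))

lemma fun_sq (hu : LpContinuous 2 σ u) : LpContinuous 1 σ fun x z => u x z ^ 2 := by
  simpa only [pow_two] using hu.fun_mul hu

lemma const_mul (c : ℝ) (hu : LpContinuous p σ u) : LpContinuous p σ fun x z => c * u x z :=
  (of_memLp (p := ∞) (memLp_top_const c)).fun_mul hu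

lemma memLp (hu : LpContinuous p σ u) (x : X) : MemLp (u x) p σ := by
  obtain ⟨T, -, hTu⟩ := hu
  exact (Lp.memLp (T x)).ae_eq (hTu x)

lemma integrable (hu : LpContinuous 1 σ u) (x : X) : Integrable (u x) σ :=
  memLp_one_iff_integrable.1 (hu.memLp x)

lemma continuous_integral (hu : LpContinuous 1 σ u) : Continuous fun x => ∫ z, u x z ∂σ := by
  obtain ⟨T, hT, hTu⟩ := hu
  exact (MeasureTheory.continuous_integral.comp hT).congr fun x => integral_congr_ae (hTu x)

end LpContinuous

end LpContinuity

section Matrix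

variable {n : ℕ}

lemma traceCLM_toEuclideanCLM (M : Matrix (Fin n) (Fin n) ℝ) :
    traceCLM (Eu n) (Matrix.toEuclideanCLM (𝕜 := ℝ) M) = M.trace := by
  rw [traceCLM_apply, LinearMap.trace_eq_sum_inner _ (EuclideanSpace.basisFun (Fin n) ℝ)]
  simp [Matrix.trace, Matrix.ofLp_toEuclideanCLM, EuclideanSpace.inner_single_left]

lemma norm_proj_comp_toEuclideanCLM_sq (M : Matrix (Fin n) (Fin n) ℝ) (i : Fin n) :
    ‖EuclideanSpace.proj i ∘L Matrix.toEuclideanCLM (𝕜 := ℝ) M‖ ^ 2 = ∑ k, M i k ^ 2 := by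
  have hrow : EuclideanSpace.proj i ∘L Matrix.toEuclideanCLM (𝕜 := ℝ) M =
      innerSL ℝ (WithLp.toLp 2 (M i) : Eu n) := by
    ext v
    simp [Matrix.ofLp_toEuclideanCLM, Matrix.mulVec, dotProduct, PiLp.inner_apply, mul_comm]
  rw [hrow, innerSL_apply_norm, EuclideanSpace.real_norm_sq_eq]

lemma trace_sq_le_frobSq (M : Matrix (Fin n) (Fin n) ℝ) : (M ^ 2).trace ≤ frobSq M := by
  have hswap : ∑ i, ∑ j, M j i ^ 2 = frobSq M := Finset.sum_comm
  calc (M ^ 2).trace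
    _ = ∑ i, ∑ j, M i j * M j i := by
      simp only [pow_two, Matrix.trace, Matrix.diag, Matrix.mul_apply]
    _ ≤ ∑ i, ∑ j, (M i j ^ 2 + M j i ^ 2) / 2 := by
      gcongr with i _ j _
      linarith [two_mul_le_add_sq (M i j) (M j i)]
    _ = frobSq M := by
      simp only [← Finset.sum_div, Finset.sum_add_distrib, hswap]
      rw [← frobSq]
      ring

lemma toEuclideanCLM_projPerp (x v : Eu n) :
    Matrix.toEuclideanCLM (𝕜 := ℝ) (projPerp x) v = v - ((‖x‖ ^ 2)⁻¹ * inner ℝ x v) • x := by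
  ext i
  simp [projPerp, Matrix.ofLp_toEuclideanCLM, Matrix.vecMulVec_mulVec,
    PiLp.inner_apply, dotProduct, mul_comm, mul_assoc]

lemma continuousOn_projPerp_apply (j k : Fin n) :
    ContinuousOn (fun x : Eu n => projPerp x j k) {0}ᶜ := by
  simp only [projPerp, Matrix.sub_apply, Matrix.smul_apply, Matrix.vecMulVec_apply, smul_eq_mul]
  have hinv : ContinuousOn (fun x : Eu n => (‖x‖ ^ 2)⁻¹) {0}ᶜ :=
    (continuous_norm.pow 2).continuousOn.inv₀ fun x hx => pow_ne_zero 2 (norm_ne_zero_iff.2 hx)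
  fun_prop

end Matrix

section SmoothExtension

variable {n : ℕ} {R : ℝ} {α : ℝ≥0∞} [Fact (1 ≤ α)]

lemma radialExt_coe (hR : 0 < R) (h : Sph n R → ℝ) (z : Sph n R) : radialExt h z = h z := by
  have hz : (R / ‖(z : Eu n)‖) • (z : Eu n) = z := by
    rw [norm_eq_of_mem_sphere z, div_self hR.ne', one_smul]
  rw [radialExt, dif_pos (hz.symm ▸ z.2)]
  exact congrArg h (Subtype.ext hz)

open Classical in
lemma isPosHomogeneous_radialExt (h : Sph n R → ℝ) : IsPosHomogeneous 0 (radialExt h) := by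
  intro c hc x
  have hproj : (R / ‖c • x‖) • c • x = (R / ‖x‖) • x := sphereProj_smul hc x
  rw [zpow_zero, one_smul]
  exact congrArg (fun y => if hy : y ∈ Metric.sphere 0 R then h ⟨y, hy⟩ else 0) hproj

lemma inner_sphereGrad (h : Sph n R → ℝ) (z : Sph n R) (v : Eu n) :
    inner ℝ (sphereGrad h z) v = fderiv ℝ (radialExt h) z v := by
  rw [sphereGrad, gradient, InnerProductSpace.toDual_symm_apply]

/-- `F` is an extension to `ℝⁿ ∖ {0}`, smooth and constant along rays, of the vector field
`val f`, whose derivative then realises the matrix `∇fᵀ P^⊥`. -/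
structure IsSmoothExtension (F : Eu n → Eu n) (f : Fin n → Sobolev n R α) : Prop where
  contDiffOn : ContDiffOn ℝ 2 F {0}ᶜ
  isPosHomogeneous : IsPosHomogeneous 0 F
  val_ae_eq : ∀ᵐ x ∂unifSphere n R, val f x = F x
  gradPerp_ae_eq : ∀ᵐ x : Sph n R ∂unifSphere n R,
    Matrix.toEuclideanCLM (𝕜 := ℝ) (gradPerp f x) = fderiv ℝ F x

lemma IsSmoothExtension.trace_gradPerp_ae_eq {F : Eu n → Eu n} {f : Fin n → Sobolev n R α}
    (hF : IsSmoothExtension F f) :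
    ∀ᵐ x : Sph n R ∂unifSphere n R, (gradPerp f x).trace = divergence F x :=
  hF.gradPerp_ae_eq.mono fun x hx => by rw [divergence, ← hx, traceCLM_toEuclideanCLM]

lemma toEuclideanCLM_gradPerp_apply (f : Fin n → Sobolev n R α) (x : Sph n R) (v : Eu n)
    (i : Fin n) : Matrix.toEuclideanCLM (𝕜 := ℝ) (gradPerp f x) v i =
      inner ℝ ((f i : LpPair n R α).snd x) (Matrix.toEuclideanCLM (𝕜 := ℝ) (projPerp x) v) := by
  rw [gradPerp, map_mul]
  simp [Matrix.ofLp_toEuclideanCLM, grad, Matrix.mulVec, dotProduct, PiLp.inner_apply, mul_comm]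

lemma exists_isSmoothExtension (hR : 0 < R) {f : Fin n → Sobolev n R α}
    (hf : ∀ i, (f i : LpPair n R α) ∈ smoothGraph n R α) : ∃ F, IsSmoothExtension F f := by
  choose h hh hfst hsnd using hf
  let F : Eu n → Eu n := fun x => WithLp.toLp 2 fun i => radialExt (h i) x
  have hF : ContDiffOn ℝ 2 F {0}ᶜ :=
    (contDiffOn_piLp 2).2 fun i => contDiffOn_infty.1 (hh i) 2
  have hhom : IsPosHomogeneous 0 F := by
    intro c hc x
    ext i
    exact isPosHomogeneous_radialExt (h i) hc x
  refine ⟨F, hF, hhom, ?_, ?_⟩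
  · filter_upwards [ae_all_iff.2 hfst] with x hx
    ext i
    exact (hx i).trans (radialExt_coe hR _ _).symm
  · filter_upwards [ae_all_iff.2 hsnd] with x hx
    have hdiff := differentiableAt_of_contDiffOn_compl_zero (hF.of_le one_le_two)
      (ne_zero_of_mem_sphere hR x)
    have hcoord (i : Fin n) : HasFDerivAt (radialExt (h i)) _ (x : Eu n) :=
      (EuclideanSpace.proj (𝕜 := ℝ) i).hasFDerivAt.comp (x : Eu n) hdiff.hasFDerivAt
    ext v i
    rw [toEuclideanCLM_gradPerp_apply, hx i, inner_sphereGrad, toEuclideanCLM_projPerp,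
      (hcoord i).fderiv]
    simp [hhom.fderiv_apply_self hdiff]

lemma dense_exists_isSmoothExtension (hR : 0 < R) :
    Dense {f : Fin n → Sobolev n R α | ∃ F, IsSmoothExtension F f} := by
  have hdense : Dense ((↑) ⁻¹' smoothGraph n R α : Set (Sobolev n R α)) := by
    have hsub : smoothGraph n R α ⊆ Sobolev n R α := subset_closure
    rw [Subtype.dense_iff, Subtype.image_preimage_coe, Set.inter_eq_right.2 hsub]
    exact subset_rfl
  exact (dense_pi Set.univ fun _ _ => hdense).mono fun f hf =>
    exists_isSmoothExtension hR fun i => Set.mem_pi.1 hf i (Set.mem_univ i)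

end SmoothExtension

section SobolevContinuity

variable {n : ℕ} {R : ℝ} {α : ℝ≥0∞} [Fact (1 ≤ α)]

lemma lpContinuous_val_apply (i : Fin n) :
    LpContinuous α (unifSphere n R) fun (f : Fin n → Sobolev n R α) x => val f x i :=
  ⟨fun f => (f i : LpPair n R α).fst,
    (WithLp.continuous_fst ..).comp (continuous_subtype_val.comp (continuous_apply i)),
    fun _ => .rfl⟩

lemma lpContinuous_grad_apply (k i : Fin n) :
    LpContinuous α (unifSphere n R) fun (f : Fin n → Sobolev n R α) x => grad f x k i :=
  let proj : Eu n →L[ℝ] ℝ := EuclideanSpace.proj k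
  ⟨fun f => proj.compLpL α (unifSphere n R) (f i : LpPair n R α).snd,
    (proj.compLpL α _).continuous.comp
      ((WithLp.continuous_snd ..).comp (continuous_subtype_val.comp (continuous_apply i))),
    fun _ => proj.coeFn_compLpL _⟩

lemma lpContinuous_norm_val_sq :
    LpContinuous 1 (unifSphere n R) fun (f : Fin n → Sobolev n R 2) x => ‖val f x‖ ^ 2 := by
  simp only [EuclideanSpace.real_norm_sq_eq]
  exact .fun_sum _ fun i => (lpContinuous_val_apply i).fun_sq

variable [NeZero n]

lemma lpContinuous_gradPerp_apply (hR : 0 < R) (i k : Fin n) :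
    LpContinuous α (unifSphere n R) fun (f : Fin n → Sobolev n R α) x => gradPerp f x i k := by
  simp only [gradPerp, Matrix.mul_apply, Matrix.transpose_apply]
  exact .fun_sum _ fun j => (lpContinuous_grad_apply j i).fun_mul
    (.of_memLp (memLp_unifSphere hR (continuousOn_projPerp_apply j k) ∞))

lemma lpContinuous_inner_val (hR : 0 < R) :
    LpContinuous α (unifSphere n R)
      fun (f : Fin n → Sobolev n R α) x => inner ℝ (val f x) (x : Eu n) := by
  simp only [PiLp.inner_apply, Real.inner_apply]
  exact .fun_sum _ fun i => (lpContinuous_val_apply i).fun_mul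
    (.of_memLp (memLp_unifSphere hR (g := fun x : Eu n => x i) (by fun_prop) ∞))

lemma lpContinuous_trace_gradPerp (hR : 0 < R) :
    LpContinuous α (unifSphere n R)
      fun (f : Fin n → Sobolev n R α) x => (gradPerp f x).trace :=
  .fun_sum _ fun i => lpContinuous_gradPerp_apply hR i i

lemma lpContinuous_trace_gradPerp_sq (hR : 0 < R) :
    LpContinuous 1 (unifSphere n R)
      fun (f : Fin n → Sobolev n R 2) x => (gradPerp f x ^ 2).trace := by
  simp only [pow_two, Matrix.trace, Matrix.diag, Matrix.mul_apply]
  exact .fun_sum _ fun i => .fun_sum _ fun k =>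
    (lpContinuous_gradPerp_apply hR i k).fun_mul (lpContinuous_gradPerp_apply hR k i)

lemma lpContinuous_frobSq_gradPerp (hR : 0 < R) :
    LpContinuous 1 (unifSphere n R)
      fun (f : Fin n → Sobolev n R 2) x => frobSq (gradPerp f x) :=
  .fun_sum _ fun i => .fun_sum _ fun k => (lpContinuous_gradPerp_apply hR i k).fun_sq

lemma lpContinuous_inner_val_sub_trace_sq (hR : 0 < R) :
    LpContinuous 1 (unifSphere n R) fun (f : Fin n → Sobolev n R 2) x =>
      (n * (R ^ 2)⁻¹ * inner ℝ (val f x) (x : Eu n) - (gradPerp f x).trace) ^ 2 :=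
  (((lpContinuous_inner_val hR).const_mul _).fun_sub (lpContinuous_trace_gradPerp hR)).fun_sq

lemma integrable_val (hR : 0 < R) (f : Fin n → Sobolev n R 2) :
    Integrable (val f) (unifSphere n R) := by
  have := isProbabilityMeasure_unifSphere (n := n) hR
  exact .of_eval_piLp fun i => ((lpContinuous_val_apply i).memLp f).integrable one_le_two

lemma lpContinuous_val_sub_integral_sq (hR : 0 < R) (i : Fin n) :
    LpContinuous 1 (unifSphere n R) fun (f : Fin n → Sobolev n R 2) x =>
      (val f x i - ∫ y, val f y i ∂unifSphere n R) ^ 2 := by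
  have := isProbabilityMeasure_unifSphere (n := n) hR
  have hval : LpContinuous 1 (unifSphere n R) fun (f : Fin n → Sobolev n R 2) x => val f x i := by
    simpa using (lpContinuous_val_apply i).fun_mul (q := 2) (.of_memLp (memLp_const 1))
  exact ((lpContinuous_val_apply i).fun_sub (.of_continuous hval.continuous_integral)).fun_sq

lemma norm_val_sub_integral_sq (hR : 0 < R) (f : Fin n → Sobolev n R 2) (x : Sph n R) :
    ‖val f x - ∫ y, val f y ∂unifSphere n R‖ ^ 2 =
      ∑ i, (val f x i - ∫ y, val f y i ∂unifSphere n R) ^ 2 := by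
  rw [EuclideanSpace.real_norm_sq_eq]
  simp only [PiLp.sub_apply, eval_integral_piLp fun i => (integrable_val hR f).eval_piLp i]

lemma lpContinuous_norm_val_sub_integral_sq (hR : 0 < R) :
    LpContinuous 1 (unifSphere n R) fun (f : Fin n → Sobolev n R 2) x =>
      ‖val f x - ∫ y, val f y ∂unifSphere n R‖ ^ 2 := by
  simp only [norm_val_sub_integral_sq hR]
  exact .fun_sum _ fun i => lpContinuous_val_sub_integral_sq hR i

end SobolevContinuity

section SteinFormulae

variable {n : ℕ} [NeZero n] {R : ℝ}

theorem integral_inner_val (hR : 0 < R) (f : Fin n → Sobolev n R 1) :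
    (n - 1) * ∫ x, inner ℝ (val f x) (x : Eu n) ∂unifSphere n R =
      R ^ 2 * ∫ x, (gradPerp f x).trace ∂unifSphere n R := by
  refine congrFun (Continuous.ext_on (dense_exists_isSmoothExtension hR)
    ((lpContinuous_inner_val hR).continuous_integral.const_mul _)
    ((lpContinuous_trace_gradPerp hR).continuous_integral.const_mul _) ?_) f
  rintro f ⟨F, hF⟩
  have hsmooth := integral_inner_eq_integral_divergence hR (hF.contDiffOn.of_le one_le_two)
    hF.isPosHomogeneous
  rw [Int.cast_zero, add_zero] at hsmooth
  convert hsmooth using 2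
  · exact integral_congr_ae (hF.val_ae_eq.mono fun x hx => by simp only [hx, real_inner_comm])
  · exact integral_congr_ae hF.trace_gradPerp_ae_eq

theorem integral_inner_val_sub_trace_sq (hR : 0 < R) (hn : n ≠ 2) (f : Fin n → Sobolev n R 2) :
    ∫ x, (n * (R ^ 2)⁻¹ * inner ℝ (val f x) (x : Eu n) - (gradPerp f x).trace) ^ 2
        ∂unifSphere n R =
      n * (R ^ 2)⁻¹ * ∫ x, ‖val f x‖ ^ 2 ∂unifSphere n R
        + n * ((n : ℝ) - 2)⁻¹ * ∫ x, (gradPerp f x ^ 2).trace ∂unifSphere n R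
        - 2 * ((n : ℝ) - 2)⁻¹ * ∫ x, (gradPerp f x).trace ^ 2 ∂unifSphere n R := by
  refine congrFun (Continuous.ext_on (dense_exists_isSmoothExtension hR)
    (lpContinuous_inner_val_sub_trace_sq hR).continuous_integral
    (((lpContinuous_norm_val_sq.continuous_integral.const_mul _).fun_add
      ((lpContinuous_trace_gradPerp_sq hR).continuous_integral.const_mul _)).fun_sub
      ((lpContinuous_trace_gradPerp hR).fun_sq.continuous_integral.const_mul _)) ?_) f
  rintro f ⟨F, hF⟩
  have hlhs : (fun x => (n * (R ^ 2)⁻¹ * inner ℝ (val f x) (x : Eu n) - (gradPerp f x).trace) ^ 2)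
      =ᵐ[unifSphere n R]
        fun x => (n * (R ^ 2)⁻¹ * inner ℝ (x : Eu n) (F x) - divergence F x) ^ 2 := by
    filter_upwards [hF.val_ae_eq, hF.trace_gradPerp_ae_eq] with x hval htrace
    rw [hval, htrace, real_inner_comm]
  have hval : (fun x => ‖val f x‖ ^ 2) =ᵐ[unifSphere n R] fun x => ‖F x‖ ^ 2 :=
    hF.val_ae_eq.mono fun x hx => by simp only [hx]
  have htrace_sq : (fun x => (gradPerp f x ^ 2).trace) =ᵐ[unifSphere n R]
      fun x => traceCLM (Eu n) (fderiv ℝ F x ∘L fderiv ℝ F x) :=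
    hF.gradPerp_ae_eq.mono fun x hx => by
      simp only [← hx, ← traceCLM_toEuclideanCLM, pow_two, map_mul, ContinuousLinearMap.mul_def]
  have hdiv : (fun x => (gradPerp f x).trace ^ 2) =ᵐ[unifSphere n R]
      fun x => divergence F x ^ 2 := hF.trace_gradPerp_ae_eq.mono fun x hx => by simp only [hx]
  simp only [integral_congr_ae hlhs, integral_congr_ae hval, integral_congr_ae htrace_sq,
    integral_congr_ae hdiv]
  exact integral_inner_sub_divergence_sq hR hn hF.contDiffOn hF.isPosHomogeneous

lemma integral_val_sub_integral_sq_le (hR : 0 < R) (hn : 3 ≤ n) (f : Fin n → Sobolev n R 2)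
    (i : Fin n) : ∫ x, (val f x i - ∫ y, val f y i ∂unifSphere n R) ^ 2 ∂unifSphere n R ≤
      R ^ 2 * ((n : ℝ) - 2)⁻¹ * ∫ x, ∑ k, gradPerp f x i k ^ 2 ∂unifSphere n R := by
  refine (dense_exists_isSmoothExtension hR).induction ?_ ?_ f
  · rintro f ⟨F, hF⟩
    let proj : Eu n →L[ℝ] ℝ := EuclideanSpace.proj i
    have hvar := variance_unifSphere_le (F := fun x => proj (F x)) hR hn
      (proj.contDiff.comp_contDiffOn (hF.contDiffOn.of_le one_le_two))
      (hF.isPosHomogeneous.clm_comp proj.toLinearMap)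
    have hval : (fun x => val f x i) =ᵐ[unifSphere n R] fun x : Sph n R => proj (F x) :=
      hF.val_ae_eq.mono fun x hx => by simp only [hx]; rfl
    have hgrad : (fun x => ∑ k, gradPerp f x i k ^ 2) =ᵐ[unifSphere n R]
        fun x : Sph n R => ‖fderiv ℝ (fun y => proj (F y)) x‖ ^ 2 := by
      filter_upwards [hF.gradPerp_ae_eq] with x hx
      have hdiff := differentiableAt_of_contDiffOn_compl_zero (hF.contDiffOn.of_le one_le_two)
        (ne_zero_of_mem_sphere hR x)
      have hfderiv : fderiv ℝ (fun y => proj (F y)) x = proj ∘L fderiv ℝ F x :=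
        (proj.hasFDerivAt.comp (x : Eu n) hdiff.hasFDerivAt).fderiv
      rw [hfderiv, ← hx, norm_proj_comp_toEuclideanCLM_sq]
    rwa [← variance_congr hval, ← integral_congr_ae hgrad, variance_eq_integral] at hvar
    exact ((lpContinuous_val_apply i).memLp f).aestronglyMeasurable.aemeasurable
  · have hgrad : LpContinuous 1 (unifSphere n R)
        fun (f : Fin n → Sobolev n R 2) x => ∑ k, gradPerp f x i k ^ 2 :=
      .fun_sum _ fun k => (lpContinuous_gradPerp_apply hR i k).fun_sq
    exact isClosed_le (lpContinuous_val_sub_integral_sq hR i).continuous_integral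
      (hgrad.continuous_integral.const_mul _)

theorem integral_norm_val_sub_integral_sq_le (hR : 0 < R) (hn : 3 ≤ n)
    (f : Fin n → Sobolev n R 2) :
    ∫ x, ‖val f x - ∫ y, val f y ∂unifSphere n R‖ ^ 2 ∂unifSphere n R ≤
      R ^ 2 * ((n : ℝ) - 2)⁻¹ * ∫ x, frobSq (gradPerp f x) ∂unifSphere n R := by
  simp only [norm_val_sub_integral_sq hR, frobSq]
  rw [integral_finsetSum _ fun i _ => (lpContinuous_val_sub_integral_sq hR i).integrable f,
    integral_finsetSum _ fun i _ => (LpContinuous.fun_sum _ fun k =>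
      (lpContinuous_gradPerp_apply hR i k).fun_sq).integrable f, Finset.mul_sum]
  exact Finset.sum_le_sum fun i _ => integral_val_sub_integral_sq_le hR hn f i

theorem integral_inner_val_sub_trace_sq_le (hR : 0 < R) (hn : 3 ≤ n)
    (f : Fin n → Sobolev n R 2) :
    ∫ x, (n * (R ^ 2)⁻¹ * inner ℝ (val f x) (x : Eu n) - (gradPerp f x).trace) ^ 2
        ∂unifSphere n R ≤
      n * (R ^ 2)⁻¹ * ∫ x, ‖val f x‖ ^ 2 ∂unifSphere n R
        + (1 - 2 / (n : ℝ))⁻¹ * ∫ x, frobSq (gradPerp f x) ∂unifSphere n R := by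
  have hn' : (3 : ℝ) ≤ n := by exact_mod_cast hn
  have hcoeff : (1 - 2 / (n : ℝ))⁻¹ = n * ((n : ℝ) - 2)⁻¹ := by
    rw [one_sub_div (by positivity), inv_div, div_eq_mul_inv]
  have hinv : 0 ≤ ((n : ℝ) - 2)⁻¹ := inv_nonneg.2 (by linarith)
  have htrace : ∫ x, (gradPerp f x ^ 2).trace ∂unifSphere n R ≤
      ∫ x, frobSq (gradPerp f x) ∂unifSphere n R :=
    integral_mono ((lpContinuous_trace_gradPerp_sq hR).integrable f)
      ((lpContinuous_frobSq_gradPerp hR).integrable f) fun x => trace_sq_le_frobSq _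
  rw [integral_inner_val_sub_trace_sq hR (by omega) f, hcoeff]
  refine (sub_le_self _ ?_).trans ?_
  · exact mul_nonneg (mul_nonneg zero_le_two hinv) (integral_nonneg fun x => sq_nonneg _)
  · gcongr

end SteinFormulae

section Law

variable {Ω S G : Type*} [MeasurableSpace Ω] [MeasurableSpace S] [NormedAddCommGroup G]
  {μ : Measure Ω} {σ : Measure S} {z : Ω → S} {g : S → G}

lemma integrable_comp_of_hasLaw (hz : HasLaw z σ μ) (hg : Integrable g σ) :
    Integrable (fun ω => g (z ω)) μ := by
  rw [← hz.map_eq] at hg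
  exact hg.comp_aemeasurable hz.aemeasurable

lemma integral_comp_of_hasLaw [NormedSpace ℝ G] (hz : HasLaw z σ μ) (hg : Integrable g σ) :
    ∫ ω, g (z ω) ∂μ = ∫ x, g x ∂σ :=
  hz.integral_comp hg.aestronglyMeasurable

end Law

end SphereStein

open SphereStein in
theorem mainTheorem3 (n : ℕ) (hn : 3 ≤ n) (R : ℝ) (hR : 0 < R)
    {Ω : Type*} [MeasurableSpace Ω] (μ : Measure Ω) [IsProbabilityMeasure μ]
    (z : Ω → Sph n R) (hz : HasLaw z (unifSphere n R) μ) :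
    -- first-order formula
    (∀ f : Fin n → Sobolev n R 1,
      Integrable (fun ω => inner ℝ (val f (z ω)) (z ω : Eu n)) μ ∧
      Integrable (fun ω => (gradPerp f (z ω)).trace) μ ∧
      ∫ ω, inner ℝ (val f (z ω)) (z ω : Eu n) ∂μ
        = ((n : ℝ) - 1)⁻¹ * R ^ 2 * ∫ ω, (gradPerp f (z ω)).trace ∂μ) ∧
    (∀ f : Fin n → Sobolev n R 2,
      -- the expectations below are finite
      Integrable (fun ω => val f (z ω)) μ ∧
      Integrable (fun ω => ‖val f (z ω) - ∫ ω', val f (z ω') ∂μ‖ ^ 2) μ ∧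
      Integrable (fun ω => ‖val f (z ω)‖ ^ 2) μ ∧
      Integrable (fun ω => frobSq (gradPerp f (z ω))) μ ∧
      Integrable (fun ω => ((gradPerp f (z ω)) ^ 2).trace) μ ∧
      Integrable (fun ω => (gradPerp f (z ω)).trace ^ 2) μ ∧
      Integrable (fun ω => ((n : ℝ) * (R ^ 2)⁻¹ * inner ℝ (val f (z ω)) (z ω : Eu n)
        - (gradPerp f (z ω)).trace) ^ 2) μ ∧
      -- Poincaré inequality
      ∫ ω, ‖val f (z ω) - ∫ ω', val f (z ω') ∂μ‖ ^ 2 ∂μ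
        ≤ ((n : ℝ) - 2)⁻¹ * R ^ 2 * ∫ ω, frobSq (gradPerp f (z ω)) ∂μ ∧
      -- second-order identity
      ∫ ω, ((n : ℝ) * (R ^ 2)⁻¹ * inner ℝ (val f (z ω)) (z ω : Eu n)
          - (gradPerp f (z ω)).trace) ^ 2 ∂μ
        = (n : ℝ) * (R ^ 2)⁻¹ * ∫ ω, ‖val f (z ω)‖ ^ 2 ∂μ
          + (n : ℝ) * ((n : ℝ) - 2)⁻¹ * ∫ ω, ((gradPerp f (z ω)) ^ 2).trace ∂μ
          - 2 * ((n : ℝ) - 2)⁻¹ * ∫ ω, (gradPerp f (z ω)).trace ^ 2 ∂μ ∧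
      -- second-order upper bound
      ∫ ω, ((n : ℝ) * (R ^ 2)⁻¹ * inner ℝ (val f (z ω)) (z ω : Eu n)
          - (gradPerp f (z ω)).trace) ^ 2 ∂μ
        ≤ (n : ℝ) * (R ^ 2)⁻¹ * ∫ ω, ‖val f (z ω)‖ ^ 2 ∂μ
          + (1 - 2 / (n : ℝ))⁻¹ * ∫ ω, frobSq (gradPerp f (z ω)) ∂μ) := by
  have : NeZero n := ⟨by omega⟩
  have hn₁ : (n : ℝ) - 1 ≠ 0 := sub_ne_zero.2 (by exact_mod_cast (by omega : n ≠ 1))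
  have hint {G : Type} [NormedAddCommGroup G] {g : Sph n R → G}
      (hg : Integrable g (unifSphere n R)) := integrable_comp_of_hasLaw hz hg
  refine ⟨fun f => ?_, fun f => ?_⟩
  · have hinner := (lpContinuous_inner_val hR).integrable f
    have htrace := (lpContinuous_trace_gradPerp hR).integrable f
    refine ⟨hint hinner, hint htrace, ?_⟩
    rw [integral_comp_of_hasLaw hz hinner, integral_comp_of_hasLaw hz htrace, mul_assoc,
      ← integral_inner_val hR f, inv_mul_cancel_left₀ hn₁]
  · have hval := integrable_val hR f
    have hvar := (lpContinuous_norm_val_sub_integral_sq hR).integrable f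
    have hsq := lpContinuous_norm_val_sq.integrable f
    have hfrob := (lpContinuous_frobSq_gradPerp hR).integrable f
    have htrace_sq := (lpContinuous_trace_gradPerp_sq hR).integrable f
    have hdiv_sq := (lpContinuous_trace_gradPerp hR).fun_sq.integrable f
    have hres := (lpContinuous_inner_val_sub_trace_sq hR).integrable f
    rw [integral_comp_of_hasLaw hz hval, integral_comp_of_hasLaw hz hvar,
      integral_comp_of_hasLaw hz hsq, integral_comp_of_hasLaw hz hfrob,
      integral_comp_of_hasLaw hz htrace_sq, integral_comp_of_hasLaw hz hdiv_sq,
      integral_comp_of_hasLaw hz hres, mul_comm _ (R ^ 2)]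
    exact ⟨hint hval, hint hvar, hint hsq, hint hfrob, hint htrace_sq, hint hdiv_sq, hint hres,
      integral_norm_val_sub_integral_sq_le hR hn f,
      integral_inner_val_sub_trace_sq hR (by omega) f,
      integral_inner_val_sub_trace_sq_le hR hn f⟩
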